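/- Let $\mathcal H$ be the upper half plane, $e(t)=e^{2\pi i t}$, $k,m\in\mathbb Z$, and let $n$ be a positive integer. For $M=\begin{pmatrix}a&b\\c&d\end{pmatrix}\in SL_2(\mathbb R)$, $\lambda,\mu\in\mathbb R$ and $F:\mathcal H\times\mathbb C\to\mathbb C$ put $$(F|_{k,m}[M,(\lambda,\mu)])(\tau,z)=(c\tau+d)^{-k}\,e\Big(m\Big(-\tfrac{c(z+\lambda\tau+\mu)^2}{c\tau+d}+\lambda^2\tau+2\lambda z+\lambda\mu\Big)\Big)\,F\Big(\tfrac{a\tau+b}{c\tau+d},\tfrac{z+\lambda\tau+\mu}{c\tau+d}\Big),$$ and for an integral matrix $M$ with $\det M=\ell>0$ put $F|_{k,m}[M,(\lambda,\mu)]:=F|_{k,m}[\ell^{-1/2}M,(\lambda,\mu)]$. Let $T=[\begin{pmatrix}0&-1\\1&0\end{pmatrix},(1,0)]$ and write $v=\operatorname{Im}\tau$, $y=\operatorname{Im}z$. Let $\mathcal P_m$ be the set of holomorphic $g:\mathcal H\times\mathbb C\to\mathbb C$ with $|g(\tau,z)|<K(|\tau|^{\rho}+v^{-\sigma})e^{2\pi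 m y^2/v}$ for some $K,\rho,\sigma>0$. Let $J^{\int}_{k,m}$ be the set of real analytic $f:\mathcal H\times\mathbb C\to\mathbb C$ with $f(\tau+1,z)=f(\tau,z)=f(\tau,z+1)$, with $f|_{k,m}\gamma-f\in\mathcal P_m$ for all $\gamma=[M,(\lambda,\mu)]$, $M\in SL_2(\mathbb Z)$, $\lambda,\mu\in\mathbb Z$, and with $|f(\tau,z)|\,v^{-k/2}e^{-2\pi m y^2/v}\to0$ as $v,y\to\infty$. Let $EJ^{\int}_{k,m}=\{f\in J^{\int}_{k,m} : f|_{k,m}[I,(1,0)]=f\}$. Put $$f|_{k,m}\mathcal T_n^\infty=n^{k-4}\sum_{\substack{ad=n^2,\ \gcd(a,b,d)=\square\\ a,d>0,\ b\bmod d\\ X,Y\in\mathbb Z/n\mathbb Z}}f|_{k,m}[\begin{pmatrix}a&b\\0&d\end{pmatrix},(X,Y)],$$ where $\square$ means a perfect square, and define the formal sum $$\tilde{\mathcal T}_n=\sum_{\substack{ad-bc=n^2,\ \gcd(a,b,c,d)=\square\\ a>c>0,\ d>-b>0\\ X,Y\in\mathbb Z/n\mathbb Z}}\Big\{[\begin{pmatrix}a&b\\c&d\end{pmatrix},(X,Y)]+[\begin{pmatrix}a&-b\\-c&d\end{pmatrix},(X,Y)]\Big\}+\sum_{\substack{ad=n^2,\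 \gcd(a,b,d)=\square\\ -d/2<b\le d/2\\ X,Y\in\mathbb Z/n\mathbb Z}}[\begin{pmatrix}a&b\\0&d\end{pmatrix},(X,Y)]+\sum_{\substack{ad=n^2,\ \gcd(a,c,d)=\square\\ -a/2<c\le a/2,\ c\ne0\\ X,Y\in\mathbb Z/n\mathbb Z}}[\begin{pmatrix}a&0\\c&d\end{pmatrix},(X,Y)]$$ (with $a,b,c,d\in\mathbb Z$), acting term by term. **Theorem 2.2.** (0) Let $f\in EJ^{\int}_{k,m}$, $f|_{k,m}T=f+P_T$. For $F\in\{f,P_T\}$ and integral $M$ with $\det M=n^2$, $F|_{k,m}[M,(X,Y)]$ depends only on $X,Y$ modulo $n$; and for $ad=n^2$, $f|_{k,m}[\begin{pmatrix}a&b\\0&d\end{pmatrix},(X,Y)]$ depends only on $b$ modulo $d$. So the sums $f|_{k,m}\mathcal T_n^\infty$ and $P_T|_{k,m}\tilde{\mathcal T}_n$ are well defined. (1) If $f\in EJ^{\int}_{k,m}$, then $f|_{k,m}\mathcal T_n^\infty\in EJ^{\int}_{k,m}$. (2) Let $f\in EJ^{\int}_{k,m}$, $f|_{k,m}T=f+P_T$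 and $(f|_{k,m}\mathcal T_n^\infty)|_{k,m}T=f|_{k,m}\mathcal T_n^\infty+\tilde P_T$. Suppose that $P_T|_{k,m}[-I,(1,0)]=P_T$. Then $\tilde P_T=n^{k-4}\,P_T|_{k,m}\tilde{\mathcal T}_n$. -/

import Mathlib

open scoped UpperHalfPlane MatrixGroups
open Filter Topology

namespace JacobiHecke

noncomputable section

/-- Complex-valued functions `F(τ, z)` on `ℍ × ℂ`. -/
abbrev JFun := ℍ → ℂ → ℂ

/-- Elements of the real Jacobi group: `[M, (lam, mu), ζ]` with `M ∈ SL₂(ℝ)`, `lam, mu ∈ ℝ`,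
`|ζ| = 1`. -/
structure RealJacobi where
  mat : SL(2, ℝ)
  lam : ℝ
  mu : ℝ
  zeta : Circle

/-- The slash operator of weight `k` and index `m`: for `g = [(a b; c d), (λ, μ), ζ]`,
`(F|g)(τ, z) = ζ^m (cτ+d)^{-k} e(m(-c(z+λτ+μ)²/(cτ+d) + λ²τ + 2λz + λμ))
  F((aτ+b)/(cτ+d), (z+λτ+μ)/(cτ+d))`. -/
def slash (k m : ℤ) (F : JFun) (g : RealJacobi) : JFun := fun τ z =>
  let j : ℂ := (g.mat 1 0 : ℂ) * (τ : ℂ) + (g.mat 1 1 : ℂ)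
  let w : ℂ := z + (g.lam : ℂ) * (τ : ℂ) + (g.mu : ℂ)
  (g.zeta : ℂ) ^ m * j ^ (-k) *
    Complex.exp (2 * (Real.pi : ℂ) * Complex.I * (m : ℂ) *
      (-((g.mat 1 0 : ℂ) * w ^ 2 / j) + (g.lam : ℂ) ^ 2 * (τ : ℂ) + 2 * (g.lam : ℂ) * z
        + (g.lam : ℂ) * (g.mu : ℂ))) *
    F (g.mat • τ) (w / j)

/-- The element `[γ, (lam, mu)]` of the full Jacobi group `SL₂(ℤ) ⋉ ℤ²`. -/
def ofSLZ (γ : SL(2, ℤ)) (lam mu : ℤ) : RealJacobi where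
  mat := Matrix.SpecialLinearGroup.map (Int.castRingHom ℝ) γ
  lam := lam
  mu := mu
  zeta := 1

/-- The matrix `ℓ^{-1/2} (a b; c d) ∈ SL₂(ℝ)`, where `ℓ = ad - bc > 0`
(by convention the identity matrix if `ad - bc ≤ 0`). -/
def normalized (a b c d : ℤ) : SL(2, ℝ) :=
  if h : 0 < a * d - b * c then
    ⟨!![(a : ℝ) / √((a * d - b * c : ℤ) : ℝ), (b : ℝ) / √((a * d - b * c : ℤ) : ℝ);
        (c : ℝ) / √((a * d - b * c : ℤ) : ℝ), (d : ℝ) / √((a * d - b * c : ℤ) : ℝ)], by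
      have h0 : (0 : ℝ) < ((a * d - b * c : ℤ) : ℝ) := by exact_mod_cast h
      rw [Matrix.det_fin_two_of, div_mul_div_comm, div_mul_div_comm,
        Real.mul_self_sqrt h0.le, ← sub_div, div_eq_one_iff_eq h0.ne']
      push_cast
      ring⟩
  else 1

/-- The element `[(a b; c d), (X, Y)]` for an integral matrix of positive determinant, acting
through the matrix divided by the square root of its determinant. -/
def ofInt (a b c d X Y : ℤ) : RealJacobi where
  mat := normalized a b c d
  lam := X
  mu := Y
  zeta := 1

/-- `T = [(0 -1; 1 0), (1, 0)]`. -/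
def elT : RealJacobi := ofSLZ ModularGroup.S 1 0

/-- The domain `{Im τ > 0} × ℂ` in `ℂ × ℂ`. -/
def domain : Set (ℂ × ℂ) := {p | 0 < p.1.im}

/-- `F`, as a function of two complex variables (relevant only on `domain`). -/
def extend (F : JFun) : ℂ × ℂ → ℂ := fun p => F (UpperHalfPlane.ofComplex p.1) p.2

/-- The space `𝒫_m` of holomorphic functions `g` on `ℍ × ℂ` with
`|g(τ, z)| < K (|τ|^ρ + v^{-σ}) e^{2 π m y² / v}` for some `K, ρ, σ > 0`,
where `v = Im τ`, `y = Im z`. -/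
def periodModule (m : ℤ) : Set JFun :=
  {g | DifferentiableOn ℂ (extend g) domain ∧
    ∃ K ρ σ : ℝ, 0 < K ∧ 0 < ρ ∧ 0 < σ ∧ ∀ (τ : ℍ) (z : ℂ),
      ‖g τ z‖ < K * (‖(τ : ℂ)‖ ^ ρ + τ.im ^ (-σ)) *
        Real.exp (2 * Real.pi * m * z.im ^ 2 / τ.im)}

/-- Jacobi integrals of weight `k` and index `m` on the full Jacobi group. -/
structure IsJacobiIntegral (k m : ℤ) (f : JFun) : Prop where
  analytic : AnalyticOnNhd ℝ (extend f) domain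
  periodic_tau : ∀ (τ : ℍ) (z : ℂ), f ((1 : ℝ) +ᵥ τ) z = f τ z
  periodic_z : ∀ (τ : ℍ) (z : ℂ), f τ (z + 1) = f τ z
  period : ∀ (γ : SL(2, ℤ)) (lam mu : ℤ), slash k m f (ofSLZ γ lam mu) - f ∈ periodModule m
  /-- `|f(τ, z)| v^{-k/2} e^{-2 π m y² / v} → 0` as `v, y → ∞`. -/
  growth : Tendsto
    (fun p : ℍ × ℂ => ‖f p.1 p.2‖ * p.1.im ^ (-(k : ℝ) / 2) *
      Real.exp (-(2 * Real.pi * m * p.2.im ^ 2 / p.1.im)))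
    (comap (fun p : ℍ × ℂ => (p.1.im, p.2.im)) (atTop ×ˢ atTop)) (𝓝 0)

/-- `EJ^∫_{k,m}`: the Jacobi integrals invariant under `[I, (1, 0)]`. -/
def EJ (k m : ℤ) : Set JFun :=
  {f | IsJacobiIntegral k m f ∧ slash k m f (ofSLZ 1 1 0) = f}

/-- `gcd(a, b, c, d)` is a perfect square. -/
abbrev GcdSquare (a b c d : ℤ) : Prop :=
  IsSquare (Nat.gcd (Int.gcd a b) (Int.gcd c d))

/-- All `(a, b, c, d)` with entries between `-n²` and `n²`; all the index sets below lie
in this box. -/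
def box (n : ℕ) : Finset (ℤ × ℤ × ℤ × ℤ) :=
  let I : Finset ℤ := Finset.Icc (-((n : ℤ) ^ 2)) ((n : ℤ) ^ 2)
  I ×ˢ I ×ˢ I ×ˢ I

/-- `ad = n²`, `a, d > 0`, `b` modulo `d`, `gcd(a, b, d)` a square (and `c = 0`). -/
def heckeIndex (n : ℕ) : Finset (ℤ × ℤ × ℤ × ℤ) :=
  (box n).filter fun (a, b, c, d) =>
    a * d = (n : ℤ) ^ 2 ∧ c = 0 ∧ 0 < a ∧ 0 < d ∧ 0 ≤ b ∧ b < d ∧ GcdSquare a b 0 d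

/-- `ad - bc = n²`, `gcd(a, b, c, d)` a square, `a > c > 0`, `d > -b > 0`. -/
def mainIndex (n : ℕ) : Finset (ℤ × ℤ × ℤ × ℤ) :=
  (box n).filter fun (a, b, c, d) =>
    a * d - b * c = (n : ℤ) ^ 2 ∧ GcdSquare a b c d ∧ c < a ∧ 0 < c ∧ -b < d ∧ 0 < -b

/-- `ad = n²`, `gcd(a, b, d)` a square, `-d/2 < b ≤ d/2` (and `c = 0`). -/
def upperIndex (n : ℕ) : Finset (ℤ × ℤ × ℤ × ℤ) :=
  (box n).filter fun (a, b, c, d) =>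
    a * d = (n : ℤ) ^ 2 ∧ c = 0 ∧ GcdSquare a b 0 d ∧ -d < 2 * b ∧ 2 * b ≤ d

/-- `ad = n²`, `gcd(a, c, d)` a square, `-a/2 < c ≤ a/2`, `c ≠ 0` (and `b = 0`). -/
def lowerIndex (n : ℕ) : Finset (ℤ × ℤ × ℤ × ℤ) :=
  (box n).filter fun (a, b, c, d) =>
    a * d = (n : ℤ) ^ 2 ∧ b = 0 ∧ GcdSquare a 0 c d ∧ -a < 2 * c ∧ 2 * c ≤ a ∧ c ≠ 0

/-- `∑_{X, Y mod n} F|[(a b; c d), (X, Y)]`, with the representatives `0 ≤ X, Y < n`. -/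
def latticeSum (k m : ℤ) (n : ℕ) (F : JFun) (a b c d : ℤ) : JFun :=
  ∑ X ∈ Finset.range n, ∑ Y ∈ Finset.range n, slash k m F (ofInt a b c d X Y)

/-- The Hecke operator `f ↦ f|T_n^∞`. -/
def heckeT (k m : ℤ) (n : ℕ) (f : JFun) : JFun :=
  (n : ℂ) ^ (k - 4) • ∑ p ∈ heckeIndex n, latticeSum k m n f p.1 p.2.1 p.2.2.1 p.2.2.2

/-- The operator `P ↦ P|𝒯̃_n` on period functions. -/
def tildeT (k m : ℤ) (n : ℕ) (P : JFun) : JFun :=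
  (∑ p ∈ mainIndex n,
    (latticeSum k m n P p.1 p.2.1 p.2.2.1 p.2.2.2
      + latticeSum k m n P p.1 (-p.2.1) (-p.2.2.1) p.2.2.2))
  + (∑ p ∈ upperIndex n, latticeSum k m n P p.1 p.2.1 p.2.2.1 p.2.2.2)
  + ∑ p ∈ lowerIndex n, latticeSum k m n P p.1 p.2.1 p.2.2.1 p.2.2.2

/-- The bounding box does not restrict the first index set. -/
theorem mem_heckeIndex {n : ℕ} {a b c d : ℤ} :
    (a, b, c, d) ∈ heckeIndex n ↔
      a * d = (n : ℤ) ^ 2 ∧ c = 0 ∧ 0 < a ∧ 0 < d ∧ 0 ≤ b ∧ b < d ∧ GcdSquare a b 0 d := by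
  simp only [heckeIndex, box, Finset.mem_filter, Finset.mem_product, Finset.mem_Icc]
  refine ⟨fun h => h.2, fun h => ⟨?_, h⟩⟩
  obtain ⟨h1, rfl, ha, hd, hb, hbd, -⟩ := h
  refine ⟨⟨?_, ?_⟩, ⟨?_, ?_⟩, ⟨?_, ?_⟩, ?_, ?_⟩ <;> nlinarith

/-- The bounding box does not restrict the second index set. -/
theorem mem_mainIndex {n : ℕ} {a b c d : ℤ} :
    (a, b, c, d) ∈ mainIndex n ↔
      a * d - b * c = (n : ℤ) ^ 2 ∧ GcdSquare a b c d ∧ c < a ∧ 0 < c ∧ -b < d ∧ 0 < -b := by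
  simp only [mainIndex, box, Finset.mem_filter, Finset.mem_product, Finset.mem_Icc]
  refine ⟨fun h => h.2, fun h => ⟨?_, h⟩⟩
  obtain ⟨h1, -, hca, hc, hbd, hb⟩ := h
  have h2 : 0 < -b * c := mul_pos hb hc
  have ha : 0 < a := by omega
  have hd : 0 < d := by omega
  refine ⟨⟨?_, ?_⟩, ⟨?_, ?_⟩, ⟨?_, ?_⟩, ?_, ?_⟩ <;> nlinarith

/-- The bounding box does not restrict the third index set, and its conditions force
`a, d > 0`. -/
theorem mem_upperIndex {n : ℕ} (hn : 0 < n) {a b c d : ℤ} :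
    (a, b, c, d) ∈ upperIndex n ↔
      a * d = (n : ℤ) ^ 2 ∧ c = 0 ∧ GcdSquare a b 0 d ∧ -d < 2 * b ∧ 2 * b ≤ d := by
  simp only [upperIndex, box, Finset.mem_filter, Finset.mem_product, Finset.mem_Icc]
  refine ⟨fun h => h.2, fun h => ⟨?_, h⟩⟩
  obtain ⟨h1, rfl, -, hb, hbd⟩ := h
  have h0 : (0 : ℤ) < (n : ℤ) ^ 2 := by positivity
  have hd : 0 < d := by omega
  have ha : 0 < a := pos_of_mul_pos_left (h1 ▸ h0) hd.le
  refine ⟨⟨?_, ?_⟩, ⟨?_, ?_⟩, ⟨?_, ?_⟩, ?_, ?_⟩ <;> nlinarith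

/-- The bounding box does not restrict the fourth index set, and its conditions force
`a, d > 0`. -/
theorem mem_lowerIndex {n : ℕ} (hn : 0 < n) {a b c d : ℤ} :
    (a, b, c, d) ∈ lowerIndex n ↔
      a * d = (n : ℤ) ^ 2 ∧ b = 0 ∧ GcdSquare a 0 c d ∧ -a < 2 * c ∧ 2 * c ≤ a ∧ c ≠ 0 := by
  simp only [lowerIndex, box, Finset.mem_filter, Finset.mem_product, Finset.mem_Icc]
  refine ⟨fun h => h.2, fun h => ⟨?_, h⟩⟩
  obtain ⟨h1, rfl, -, hb, hbd, -⟩ := h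
  have h0 : (0 : ℤ) < (n : ℤ) ^ 2 := by positivity
  have ha : 0 < a := by omega
  have hd : 0 < d := pos_of_mul_pos_right (h1 ▸ h0) ha.le
  refine ⟨⟨?_, ?_⟩, ⟨?_, ?_⟩, ⟨?_, ?_⟩, ?_, ?_⟩ <;> nlinarith

end

end JacobiHecke

/-!
The slash operator is a right action of the Jacobi group (`slash_slash`), with a central cocycle that
is trivial whenever the lattice vectors involved are integral. A function `f ∈ EJ` is invariant under
all of `ℤ²`, and `n² (r, s) M⁻¹` is integral for `det M = n²`; hence `f|[M, (X, Y)]` depends on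
`X, Y` modulo `n` only, and `φ(M) = ∑_{X, Y} f|[M, (X, Y)]` satisfies
`φ(M)|[γ, (λ, μ)] = φ(Mγ)` and `φ(γM) = ∑_{X, Y} (f|γ)|[M, (X, Y)]` for `γ ∈ SL₂(ℤ)`
(`LatticeInvariant.latticeSum_slash`, `LatticeInvariant.slash_latticeSum`).

*The Hecke operator preserves Jacobi integrals.* By Hermite normal form, right multiplication by `γ`
permutes the cosets of the Hecke representatives, `Mγ = δ M'` (`exists_hecke_perm`). So
`f|T_n^∞|γ - f|T_n^∞` is a sum of terms `(f|δ - f)|[M', (X, Y)]` (`heckeT_slash_sub`), and `𝒫_m` is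
stable under the action of the whole real Jacobi group (`periodModule_slash`), because
`‖F‖ e^{-2π m y²/v}` changes only by the factor `|cτ + d|^{-k}` and moderate growth in `τ` is preserved.

*The period function.* If `f|S = f + P` and `P|(-I) = P`, then `f|(-I) = f` (`slash_neg_one`). Hence
`φ(M)` depends only on the lattice spanned by the rows of `M` and, up to sign, on the second row. For
a basis `M` with rows `v₁, v₂` of a lattice `Λ`, the lattice sum of `P` over `M` is
`φ(SM) - φ(M) = φ_Λ(v₁) - φ_Λ(v₂)`. The matrices occurring in `𝒯̃_n` are exactly the reduced bases,
and those of a given `Λ` form a chain: each vector that is first in one basis is, up to sign, second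
in the next (`nextBasis`), from the primitive vector on the vertical axis to the one on the horizontal
axis. The sum over the chain telescopes to `φ_Λ(horizontal) - φ_Λ(vertical)`, which is `φ(MS) - φ(M)`
for the Hecke representative `M` of `Λ` (`sum_hecke_eq_sum_chain`).
-/

namespace JacobiHecke

noncomputable section

/-! ### The Jacobi group and its action -/

/-- The product in the real Jacobi group, `[M, X][M', X'] = [MM', XM' + X']` up to the central
factor `e(det(XM'; X'))`. -/
def RealJacobi.comp (g h : RealJacobi) : RealJacobi where
  mat := g.mat * h.mat
  lam := g.lam * h.mat 0 0 + g.mu * h.mat 1 0 + h.lam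
  mu := g.lam * h.mat 0 1 + g.mu * h.mat 1 1 + h.mu
  zeta := g.zeta * h.zeta * Circle.exp (2 * Real.pi *
    ((g.lam * h.mat 0 0 + g.mu * h.mat 1 0) * h.mu - (g.lam * h.mat 0 1 + g.mu * h.mat 1 1) * h.lam))

theorem det_eq_one {R : Type*} [CommRing R] (g : SL(2, R)) : g 0 0 * g 1 1 - g 0 1 * g 1 0 = 1 := by
  rw [← Matrix.det_fin_two, g.det_coe]

/-- The automorphy factor does not vanish on the upper half plane. -/
theorem denom_ne_zero (g : SL(2, ℝ)) {t : ℂ} (ht : 0 < t.im) :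
    (g 1 0 : ℂ) * t + (g 1 1 : ℂ) ≠ 0 := by
  intro h
  have h1 := congrArg Complex.im h
  have h2 := congrArg Complex.re h
  simp at h1 h2
  have h3 : g 1 0 = 0 := by
    rcases h1 with h1 | h1
    · exact h1
    · exact absurd h1 ht.ne'
  have h4 := det_eq_one g
  simp [h3] at h2 h4
  simp [h2] at h4

theorem coe_smul (g : SL(2, ℝ)) (τ : ℍ) :
    ((g • τ : ℍ) : ℂ) = ((g 0 0 : ℂ) * τ + (g 0 1 : ℂ)) / ((g 1 0 : ℂ) * τ + (g 1 1 : ℂ)) := by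
  simpa using UpperHalfPlane.coe_specialLinearGroup_apply g τ

/-- The slash operator is a right action of the real Jacobi group. -/
theorem slash_slash (k m : ℤ) (F : JFun) (g h : RealJacobi) :
    slash k m (slash k m F g) h = slash k m F (g.comp h) := by
  funext τ z
  have hJ : (h.mat 1 0 : ℂ) * τ + (h.mat 1 1 : ℂ) ≠ 0 := denom_ne_zero h.mat τ.im_pos
  have hK : (g.mat 1 0 : ℂ) * ((h.mat • τ : ℍ) : ℂ) + (g.mat 1 1 : ℂ) ≠ 0 :=
    denom_ne_zero g.mat (h.mat • τ).im_pos
  have hdet : (h.mat 0 0 : ℂ) * h.mat 1 1 - h.mat 0 1 * h.mat 1 0 = 1 := by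
    exact_mod_cast det_eq_one h.mat
  have hm (i j : Fin 2) : ((g.mat * h.mat) i j : ℝ) =
      g.mat i 0 * h.mat 0 j + g.mat i 1 * h.mat 1 j := by
    simp [Matrix.mul_apply, Fin.sum_univ_two]
  simp only [slash, RealJacobi.comp, mul_smul, hm]
  rw [coe_smul h.mat τ] at hK ⊢
  push_cast
  generalize (h.mat 0 0 : ℂ) = a' at *
  generalize (h.mat 0 1 : ℂ) = b' at *
  generalize (h.mat 1 0 : ℂ) = c' at *
  generalize (h.mat 1 1 : ℂ) = d' at *
  generalize (g.mat 1 0 : ℂ) = c at *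
  generalize (g.mat 1 1 : ℂ) = d at *
  generalize (g.lam : ℂ) = l at *
  generalize (g.mu : ℂ) = u at *
  generalize (h.lam : ℂ) = l' at *
  generalize (h.mu : ℂ) = u' at *
  generalize (τ : ℂ) = t at *
  set J := c' * t + d' with hJd
  have hjj : (c * a' + d * c') * t + (c * b' + d * d') = (c * ((a' * t + b') / J) + d) * J := by
    field_simp
    rw [hJd]; ring
  have hww : z + (l * a' + u * c' + l') * t + (l * b' + u * d' + u')
      = (((z + l' * t + u') / J) + l * ((a' * t + b') / J) + u) * J := by
    field_simp
    rw [hJd]; ring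
  rw [hjj, hww]
  set j := c * ((a' * t + b') / J) + d with hjd
  set w := (z + l' * t + u') / J + l * ((a' * t + b') / J) + u with hwd
  rw [mul_div_mul_right _ _ hJ, mul_zpow, mul_zpow, mul_zpow, ← Complex.exp_int_mul]
  rw [show ∀ A B C D E G X : ℂ, A * B * C * (D * E * G * X) = A * B * (D * E) * (C * G) * X by
      intros; ring,
    show ∀ A B C D E G X : ℂ, A * B * C * (D * E) * G * X = B * E * (A * D) * (C * G) * X by
      intros; ring]
  congr 2
  rw [← Complex.exp_add, ← Complex.exp_add]
  congr 1
  -- It remains to compare the exponents. In terms of `J = c't + d'`, `s = (a't + b') / J` and `w`,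
  -- the identity is polynomial modulo the determinant relation `c' s J = a' J - 1`.
  have h1 : c' * ((a' * t + b') / J) = a' - 1 / J := by
    field_simp
    rw [hJd]
    linear_combination -hdet
  have h2 : (c * a' + d * c') * J = c + c' * (j * J) := by
    rw [hjd]
    linear_combination (-c * J) * h1 + c * mul_one_div_cancel hJ
  clear_value w j J
  replace h2 : (c * a' + d * c') * (w * J) ^ 2 / (j * J) = c * w ^ 2 / j + c' * w ^ 2 * J := by
    field_simp
    linear_combination w ^ 2 * h2
  have h3 : z = (w - u - l * ((a' * t + b') / J)) * J - l' * t - u' := by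
    rw [hwd]; field_simp; ring
  have h4 : c' * (z + l' * t + u') ^ 2 / J = c' * J * (w - u - l * ((a' * t + b') / J)) ^ 2 := by
    rw [h3]; field_simp; ring
  have h5 : (z + l' * t + u') / J = w - u - l * ((a' * t + b') / J) := by
    rw [hwd]; ring
  have hs : b' = (a' * t + b') / J * J - a' * t := by field_simp; ring
  have h6 : c' * ((a' * t + b') / J) * J = a' * J - 1 := by
    rw [h1]; field_simp
  rw [h2, h4, h5]
  generalize (a' * t + b') / J = s at *
  have hd' : d' = J - c' * t := by rw [hJd]; ring
  subst hs
  subst hd'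
  subst h3
  linear_combination (2 * Real.pi * Complex.I * m) * (2 * w * l - u * l - l ^ 2 * s) * h6

theorem RealJacobi.comp_eq {g h r : RealJacobi} (hg : g.zeta = 1) (hh : h.zeta = 1)
    (hr : r.zeta = 1) (hmat : g.mat * h.mat = r.mat)
    (hlam : g.lam * h.mat 0 0 + g.mu * h.mat 1 0 + h.lam = r.lam)
    (hmu : g.lam * h.mat 0 1 + g.mu * h.mat 1 1 + h.mu = r.mu) (N : ℤ)
    (hN : (g.lam * h.mat 0 0 + g.mu * h.mat 1 0) * h.mu
      - (g.lam * h.mat 0 1 + g.mu * h.mat 1 1) * h.lam = N) : g.comp h = r := by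
  rcases r with ⟨rm, rl, ru, rz⟩
  simp only at hr hmat hlam hmu
  have hz : Circle.exp (2 * Real.pi * (N : ℝ)) = 1 := by
    rw [mul_comm]
    exact Circle.exp_int_mul_two_pi N
  simp only [RealJacobi.comp, hN, hz, hg, hh, hr, hmat, hlam, hmu, mul_one]

/-- The action of a fixed element of the Jacobi group, as a linear map. -/
def slashLin (k m : ℤ) (g : RealJacobi) : JFun →ₗ[ℂ] JFun where
  toFun F := slash k m F g
  map_add' F G := by
    funext τ z
    simp only [slash, Pi.add_apply, mul_add]
  map_smul' s F := by
    funext τ z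
    simp only [slash, Pi.smul_apply, smul_eq_mul, RingHom.id_apply]
    ring

theorem slash_add (k m : ℤ) (F G : JFun) (g : RealJacobi) :
    slash k m (F + G) g = slash k m F g + slash k m G g := (slashLin k m g).map_add F G

theorem slash_sub (k m : ℤ) (F G : JFun) (g : RealJacobi) :
    slash k m (F - G) g = slash k m F g - slash k m G g := (slashLin k m g).map_sub F G

theorem slash_smul (k m : ℤ) (s : ℂ) (F : JFun) (g : RealJacobi) :
    slash k m (s • F) g = s • slash k m F g := (slashLin k m g).map_smul s F

theorem slash_sum (k m : ℤ) {ι : Type*} (s : Finset ι) (F : ι → JFun) (g : RealJacobi) :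
    slash k m (∑ i ∈ s, F i) g = ∑ i ∈ s, slash k m (F i) g := map_sum (slashLin k m g) F s

theorem normalized_coe {n : ℕ} (hn : 0 < n) {a b c d : ℤ} (h : a * d - b * c = (n : ℤ) ^ 2) :
    (normalized a b c d : Matrix (Fin 2) (Fin 2) ℝ)
      = !![(a : ℝ) / n, (b : ℝ) / n; (c : ℝ) / n, (d : ℝ) / n] := by
  have h0 : 0 < a * d - b * c := by rw [h]; positivity
  have hs : √((a * d - b * c : ℤ) : ℝ) = n := by
    rw [h]; push_cast; exact Real.sqrt_sq (by positivity)
  have e : normalized a b c d = _ := dif_pos h0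
  rw [e]
  simp only [hs]

/-- The determinant of `Mγ` for `γ ∈ SL₂(ℤ)`, in terms of the entries. -/
theorem det_mul_right (γ : SL(2, ℤ)) {a b c d D : ℤ} (h : a * d - b * c = D) :
    (a * γ 0 0 + b * γ 1 0) * (c * γ 0 1 + d * γ 1 1)
      - (a * γ 0 1 + b * γ 1 1) * (c * γ 0 0 + d * γ 1 0) = D := by
  have hγ : γ 0 0 * γ 1 1 - γ 0 1 * γ 1 0 = 1 := det_eq_one γ
  linear_combination (a * d - b * c) * hγ + h

theorem det_mul_left (γ : SL(2, ℤ)) {a b c d D : ℤ} (h : a * d - b * c = D) :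
    (γ 0 0 * a + γ 0 1 * c) * (γ 1 0 * b + γ 1 1 * d)
      - (γ 0 0 * b + γ 0 1 * d) * (γ 1 0 * a + γ 1 1 * c) = D := by
  have hγ : γ 0 0 * γ 1 1 - γ 0 1 * γ 1 0 = 1 := det_eq_one γ
  linear_combination (a * d - b * c) * hγ + h

theorem ofSLZ_mat (γ : SL(2, ℤ)) (lam mu : ℤ) (i j : Fin 2) :
    (ofSLZ γ lam mu).mat i j = (γ i j : ℝ) := by
  simp [ofSLZ]

theorem slash_ofSLZ_one (k m : ℤ) (F : JFun) : slash k m F (ofSLZ 1 0 0) = F := by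
  funext τ z
  simp [slash, ofSLZ]

theorem slash_ofSLZ_ofSLZ (k m : ℤ) (F : JFun) (γ γ' : SL(2, ℤ)) (lam mu lam' mu' : ℤ) :
    slash k m (slash k m F (ofSLZ γ lam mu)) (ofSLZ γ' lam' mu') =
      slash k m F (ofSLZ (γ * γ') (lam * γ' 0 0 + mu * γ' 1 0 + lam')
        (lam * γ' 0 1 + mu * γ' 1 1 + mu')) := by
  rw [slash_slash]
  congr 1
  refine RealJacobi.comp_eq rfl rfl rfl ?_ ?_ ?_
    ((lam * γ' 0 0 + mu * γ' 1 0) * mu' - (lam * γ' 0 1 + mu * γ' 1 1) * lam') ?_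
  · simp [ofSLZ]
  all_goals
    simp only [ofSLZ_mat]
    simp [ofSLZ]

theorem slash_ofInt_ofSLZ (k m : ℤ) (F : JFun) {n : ℕ} (hn : 0 < n) {a b c d : ℤ}
    (h : a * d - b * c = (n : ℤ) ^ 2) (X Y : ℤ) (γ : SL(2, ℤ)) (lam mu : ℤ) :
    slash k m (slash k m F (ofInt a b c d X Y)) (ofSLZ γ lam mu) =
      slash k m F (ofInt (a * γ 0 0 + b * γ 1 0) (a * γ 0 1 + b * γ 1 1)
        (c * γ 0 0 + d * γ 1 0) (c * γ 0 1 + d * γ 1 1)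
        (X * γ 0 0 + Y * γ 1 0 + lam) (X * γ 0 1 + Y * γ 1 1 + mu)) := by
  rw [slash_slash]
  congr 1
  refine RealJacobi.comp_eq rfl rfl rfl ?_ ?_ ?_
    ((X * γ 0 0 + Y * γ 1 0) * mu - (X * γ 0 1 + Y * γ 1 1) * lam) ?_
  · ext i j
    simp only [ofInt, normalized_coe hn h, normalized_coe hn (det_mul_right γ h),
      Matrix.SpecialLinearGroup.coe_mul, Matrix.mul_apply, Fin.sum_univ_two, ofSLZ_mat]
    fin_cases i <;> fin_cases j <;> simp <;> ring
  all_goals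
    simp only [ofSLZ_mat]
    simp [ofSLZ, ofInt]

theorem slash_ofSLZ_ofInt (k m : ℤ) (F : JFun) {n : ℕ} (hn : 0 < n) {a b c d : ℤ}
    (h : a * d - b * c = (n : ℤ) ^ 2) (X Y : ℤ) (γ : SL(2, ℤ)) :
    slash k m (slash k m F (ofSLZ γ 0 0)) (ofInt a b c d X Y) =
      slash k m F (ofInt (γ 0 0 * a + γ 0 1 * c) (γ 0 0 * b + γ 0 1 * d)
        (γ 1 0 * a + γ 1 1 * c) (γ 1 0 * b + γ 1 1 * d) X Y) := by
  rw [slash_slash]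
  congr 1
  refine RealJacobi.comp_eq rfl rfl rfl ?_ ?_ ?_ 0 ?_
  · ext i j
    simp only [ofInt, normalized_coe hn h, normalized_coe hn (det_mul_left γ h),
      Matrix.SpecialLinearGroup.coe_mul, Matrix.mul_apply, Fin.sum_univ_two, ofSLZ_mat]
    fin_cases i <;> fin_cases j <;> simp <;> ring
  all_goals simp [ofSLZ, ofInt]

/-- Translating the lattice part of an integral matrix `M` of determinant `n²` by `n (r, s)` amounts
to a preceding action of `[I, n² (r, s) M⁻¹]`, which is integral. -/
theorem slash_lattice_ofInt (k m : ℤ) (F : JFun) {n : ℕ} (hn : 0 < n) {a b c d : ℤ}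
    (h : a * d - b * c = (n : ℤ) ^ 2) (X Y r s : ℤ) :
    slash k m (slash k m F (ofSLZ 1 (r * d - s * c) (s * a - r * b))) (ofInt a b c d X Y) =
      slash k m F (ofInt a b c d (X + n * r) (Y + n * s)) := by
  have hn' : (n : ℝ) ≠ 0 := by positivity
  have hR : (a : ℝ) * d - b * c = (n : ℝ) ^ 2 := by exact_mod_cast h
  have h1 : ((r : ℝ) * d - s * c) * (a / n) + (s * a - r * b) * (c / n) = n * r := by
    field_simp
    linear_combination (r : ℝ) * hR
  have h2 : ((r : ℝ) * d - s * c) * (b / n) + (s * a - r * b) * (d / n) = n * s := by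
    field_simp
    linear_combination (s : ℝ) * hR
  rw [slash_slash]
  congr 1
  refine RealJacobi.comp_eq rfl rfl rfl ?_ ?_ ?_ (n * r * Y - n * s * X) ?_
  · simp [ofSLZ, ofInt]
  all_goals
    simp only [ofInt, normalized_coe hn h]
    simp [ofSLZ, h1, h2]
  all_goals ring

/-! ### Sums over residue classes of lattice vectors -/

/-- Invariance under the lattice part `ℤ²` of the Jacobi group. -/
def LatticeInvariant (k m : ℤ) (F : JFun) : Prop := ∀ r s : ℤ, slash k m F (ofSLZ 1 r s) = F

/-- `ℤ²` is generated by `(1, 0)` and `(0, 1)`. -/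
theorem latticeInvariant_of_generators {k m : ℤ} {F : JFun} (h1 : slash k m F (ofSLZ 1 1 0) = F)
    (h2 : slash k m F (ofSLZ 1 0 1) = F) : LatticeInvariant k m F := by
  have hadd (r s r' s' : ℤ) : slash k m (slash k m F (ofSLZ 1 r s)) (ofSLZ 1 r' s')
      = slash k m F (ofSLZ 1 (r + r') (s + s')) := by
    rw [slash_ofSLZ_ofSLZ]; simp
  have hl (r : ℤ) : slash k m F (ofSLZ 1 r 0) = F := by
    induction r using Int.induction_on with
    | zero => exact slash_ofSLZ_one k m F
    | succ i ih => simpa [ih, h1] using (hadd i 0 1 0).symm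
    | pred i ih => simpa [ih, h1] using hadd 1 0 (-(i : ℤ) - 1) 0
  have hr (s : ℤ) : slash k m F (ofSLZ 1 0 s) = F := by
    induction s using Int.induction_on with
    | zero => exact slash_ofSLZ_one k m F
    | succ i ih => simpa [ih, h2] using (hadd 0 i 0 1).symm
    | pred i ih => simpa [ih, h2] using hadd 0 1 0 (-(i : ℤ) - 1)
  intro r s
  have := hadd r 0 0 s
  rw [hl, hr] at this
  simpa using this.symm

theorem slash_translation_z (k m : ℤ) (F : JFun) (τ : ℍ) (z : ℂ) :
    slash k m F (ofSLZ 1 0 1) τ z = F τ (z + 1) := by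
  simp [slash, ofSLZ]

theorem slash_translation_tau (k m : ℤ) (F : JFun) (τ : ℍ) (z : ℂ) :
    slash k m F (ofSLZ ModularGroup.T 0 0) τ z = F ((1 : ℝ) +ᵥ τ) z := by
  have : (ofSLZ ModularGroup.T 0 0).mat • τ = (1 : ℝ) +ᵥ τ := by
    ext
    rw [coe_smul]
    simp only [ofSLZ_mat]
    simp [ModularGroup.T, add_comm]
  simp only [slash, this, ofSLZ_mat]
  simp [ofSLZ, ModularGroup.T]

theorem EJ.latticeInvariant {k m : ℤ} {f : JFun} (hf : f ∈ EJ k m) : LatticeInvariant k m f :=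
  latticeInvariant_of_generators hf.2 <| by
    funext τ z
    rw [slash_translation_z, hf.1.periodic_z]

theorem IsJacobiIntegral.slash_T {k m : ℤ} {f : JFun} (hf : IsJacobiIntegral k m f) :
    slash k m f (ofSLZ ModularGroup.T 0 0) = f := by
  funext τ z
  rw [slash_translation_tau, hf.periodic_tau]

namespace LatticeInvariant

variable {k m : ℤ} {F G : JFun}

theorem sub (hF : LatticeInvariant k m F) (hG : LatticeInvariant k m G) :
    LatticeInvariant k m (F - G) := fun r s => by rw [slash_sub, hF, hG]

theorem slash_eq (hF : LatticeInvariant k m F) (γ : SL(2, ℤ)) (lam mu : ℤ) :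
    slash k m F (ofSLZ γ lam mu) = slash k m F (ofSLZ γ 0 0) := by
  have hγ : γ 0 0 * γ 1 1 - γ 0 1 * γ 1 0 = 1 := det_eq_one γ
  -- `[γ, (λ, μ)] = [I, (λ, μ) γ⁻¹] [γ, 0]`
  conv_rhs => rw [← hF (lam * γ 1 1 - mu * γ 1 0) (mu * γ 0 0 - lam * γ 0 1), slash_ofSLZ_ofSLZ]
  congr 2
  · simp
  · linear_combination -lam * hγ
  · linear_combination -mu * hγ

theorem slash (hF : LatticeInvariant k m F) (γ : SL(2, ℤ)) (lam mu : ℤ) :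
    LatticeInvariant k m (slash k m F (ofSLZ γ lam mu)) := fun r s => by
  rw [slash_ofSLZ_ofSLZ, mul_one, hF.slash_eq, hF.slash_eq γ lam]

/-- The action of `[M, (X, Y)]` with `det M = n²` depends only on `X, Y` modulo `n`. -/
theorem slash_ofInt_congr (hF : LatticeInvariant k m F) {n : ℕ} (hn : 0 < n) {a b c d : ℤ}
    (h : a * d - b * c = (n : ℤ) ^ 2) {X Y X' Y' : ℤ} (hX : X ≡ X' [ZMOD n])
    (hY : Y ≡ Y' [ZMOD n]) :
    JacobiHecke.slash k m F (ofInt a b c d X Y) =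
      JacobiHecke.slash k m F (ofInt a b c d X' Y') := by
  obtain ⟨r, hr⟩ := hX.dvd
  obtain ⟨s, hs⟩ := hY.dvd
  have := slash_lattice_ofInt k m F hn h X Y r s
  rw [hF, ← hr, ← hs] at this
  simpa using this

/-- `∑_{X, Y mod n} F|[M, (X, Y)]` may be computed with any representatives. -/
theorem latticeSum_eq (hF : LatticeInvariant k m F) {n : ℕ} [NeZero n] {a b c d : ℤ}
    (h : a * d - b * c = (n : ℤ) ^ 2) (e : ZMod n × ZMod n → ZMod n × ZMod n)
    (he : Function.Bijective e) (X Y : ZMod n × ZMod n → ℤ)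
    (hX : ∀ p, (X p : ZMod n) = (e p).1) (hY : ∀ p, (Y p : ZMod n) = (e p).2) :
    latticeSum k m n F a b c d = ∑ p, JacobiHecke.slash k m F (ofInt a b c d (X p) (Y p)) := by
  have key (q : ℕ → JFun) : ∑ x ∈ Finset.range n, q x = ∑ x : ZMod n, q x.val := by
    refine Finset.sum_bij' (fun x _ => (x : ZMod n)) (fun x _ => x.val) ?_ ?_ ?_ ?_ ?_
    · simp
    · intro x _; exact Finset.mem_range.2 x.val_lt
    · intro x hx; exact ZMod.val_cast_of_lt (Finset.mem_range.1 hx)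
    · simp
    · intro x hx; rw [ZMod.val_cast_of_lt (Finset.mem_range.1 hx)]
  have hn : 0 < n := NeZero.pos n
  calc latticeSum k m n F a b c d
      = ∑ p : ZMod n × ZMod n, JacobiHecke.slash k m F (ofInt a b c d p.1.val p.2.val) := by
        rw [latticeSum, Fintype.sum_prod_type, key]
        exact Finset.sum_congr rfl fun x _ => key _
    _ = ∑ p, JacobiHecke.slash k m F (ofInt a b c d (e p).1.val (e p).2.val) :=
        (he.sum_comp fun p => JacobiHecke.slash k m F (ofInt a b c d p.1.val p.2.val)).symm
    _ = _ := by
        refine Finset.sum_congr rfl fun p _ => hF.slash_ofInt_congr hn h ?_ ?_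
        · rw [← ZMod.intCast_eq_intCast_iff, hX]; simp
        · rw [← ZMod.intCast_eq_intCast_iff, hY]; simp

/-- Acting on the right by `[γ, (λ, μ)]` permutes the residue classes of `(X, Y)` affinely. -/
theorem latticeSum_slash (hF : LatticeInvariant k m F) {n : ℕ} (hn : 0 < n) {a b c d : ℤ}
    (h : a * d - b * c = (n : ℤ) ^ 2) (γ : SL(2, ℤ)) (lam mu : ℤ) :
    JacobiHecke.slash k m (latticeSum k m n F a b c d) (ofSLZ γ lam mu) =
      latticeSum k m n F (a * γ 0 0 + b * γ 1 0) (a * γ 0 1 + b * γ 1 1)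
        (c * γ 0 0 + d * γ 1 0) (c * γ 0 1 + d * γ 1 1) := by
  have : NeZero n := ⟨hn.ne'⟩
  have hγ : γ 0 0 * γ 1 1 - γ 0 1 * γ 1 0 = 1 := det_eq_one γ
  have hγ' : (γ 0 0 : ZMod n) * γ 1 1 - γ 0 1 * γ 1 0 = 1 := by 
    exact_mod_cast congrArg (Int.cast : ℤ → ZMod n) hγ
  rw [hF.latticeSum_eq h id Function.bijective_id (fun p => (p.1.val : ℤ))
      (fun p => (p.2.val : ℤ)) (by simp) (by simp),
    hF.latticeSum_eq (det_mul_right γ h)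
      (fun p => (p.1 * γ 0 0 + p.2 * γ 1 0 + lam, p.1 * γ 0 1 + p.2 * γ 1 1 + mu)) ?_
      (fun p => p.1.val * γ 0 0 + p.2.val * γ 1 0 + lam)
      (fun p => p.1.val * γ 0 1 + p.2.val * γ 1 1 + mu) (by simp) (by simp), slash_sum]
  · exact Finset.sum_congr rfl fun p _ => slash_ofInt_ofSLZ k m F hn h _ _ γ lam mu
  · refine Finite.injective_iff_bijective.1 ?_
    rintro ⟨x, y⟩ ⟨x', y'⟩ hxy
    obtain ⟨h1, h2⟩ := Prod.mk.inj hxy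
    refine Prod.ext ?_ ?_
    · linear_combination (γ 1 1 : ZMod n) * h1 - (γ 1 0 : ZMod n) * h2 - (x - x') * hγ'
    · linear_combination (γ 0 0 : ZMod n) * h2 - (γ 0 1 : ZMod n) * h1 - (y - y') * hγ'

theorem slash_latticeSum (hF : LatticeInvariant k m F) {n : ℕ} (hn : 0 < n) {a b c d : ℤ}
    (h : a * d - b * c = (n : ℤ) ^ 2) (γ : SL(2, ℤ)) (lam mu : ℤ) :
    latticeSum k m n (JacobiHecke.slash k m F (ofSLZ γ lam mu)) a b c d =
      latticeSum k m n F (γ 0 0 * a + γ 0 1 * c) (γ 0 0 * b + γ 0 1 * d)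
        (γ 1 0 * a + γ 1 1 * c) (γ 1 0 * b + γ 1 1 * d) := by
  rw [hF.slash_eq]
  exact Finset.sum_congr rfl fun X _ => Finset.sum_congr rfl fun Y _ =>
    slash_ofSLZ_ofInt k m F hn h X Y γ

end LatticeInvariant

theorem latticeSum_sub (k m : ℤ) (n : ℕ) (F G : JFun) (a b c d : ℤ) :
    latticeSum k m n (F - G) a b c d = latticeSum k m n F a b c d - latticeSum k m n G a b c d := by
  simp only [latticeSum, slash_sub, Finset.sum_sub_distrib]

/-! ### Integral matrices of determinant `n²` and chains of reduced bases -/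

theorem dvd_gcd_iff (x a b c d : ℤ) : x ∣ (Nat.gcd (Int.gcd a b) (Int.gcd c d) : ℤ) ↔
    (x ∣ a ∧ x ∣ b) ∧ x ∣ c ∧ x ∣ d := by
  rw [← Int.gcd_natCast_natCast, Int.dvd_coe_gcd_iff, Int.dvd_coe_gcd_iff, Int.dvd_coe_gcd_iff]

theorem gcdSquare_congr {a b c d a' b' c' d' : ℤ}
    (h : ∀ x : ℤ, (x ∣ a ∧ x ∣ b) ∧ x ∣ c ∧ x ∣ d → (x ∣ a' ∧ x ∣ b') ∧ x ∣ c' ∧ x ∣ d')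
    (h' : ∀ x : ℤ, (x ∣ a' ∧ x ∣ b') ∧ x ∣ c' ∧ x ∣ d' → (x ∣ a ∧ x ∣ b) ∧ x ∣ c ∧ x ∣ d) :
    GcdSquare a b c d ↔ GcdSquare a' b' c' d' := by
  have : Nat.gcd (Int.gcd a b) (Int.gcd c d) = Nat.gcd (Int.gcd a' b') (Int.gcd c' d') := by
    apply Nat.dvd_antisymm <;> rw [← Int.natCast_dvd_natCast, dvd_gcd_iff]
    · exact h _ ((dvd_gcd_iff _ _ _ _ _).1 dvd_rfl)
    · exact h' _ ((dvd_gcd_iff _ _ _ _ _).1 dvd_rfl)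
  rw [GcdSquare, GcdSquare, this]

theorem gcdSquare_mul_left {p q r s : ℤ} (hγ : p * s - q * r = 1) (a b c d : ℤ) :
    GcdSquare (p * a + q * c) (p * b + q * d) (r * a + s * c) (r * b + s * d) ↔
      GcdSquare a b c d := by
  refine gcdSquare_congr ?_ ?_
  · rintro x ⟨⟨h1, h2⟩, h3, h4⟩
    refine ⟨⟨?_, ?_⟩, ?_, ?_⟩
    · have e : s * (p * a + q * c) - q * (r * a + s * c) = a := by linear_combination a * hγ
      exact e ▸ (h1.mul_left s).sub (h3.mul_left q)
    · have e : s * (p * b + q * d) - q * (r * b + s * d) = b := by linear_combination b * hγ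
      exact e ▸ (h2.mul_left s).sub (h4.mul_left q)
    · have e : p * (r * a + s * c) - r * (p * a + q * c) = c := by linear_combination c * hγ
      exact e ▸ (h3.mul_left p).sub (h1.mul_left r)
    · have e : p * (r * b + s * d) - r * (p * b + q * d) = d := by linear_combination d * hγ
      exact e ▸ (h4.mul_left p).sub (h2.mul_left r)
  · rintro x ⟨⟨h1, h2⟩, h3, h4⟩
    exact ⟨⟨(h1.mul_left _).add (h3.mul_left _), (h2.mul_left _).add (h4.mul_left _)⟩,
      (h1.mul_left _).add (h3.mul_left _), (h2.mul_left _).add (h4.mul_left _)⟩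

theorem gcdSquare_swap (a b c d : ℤ) : GcdSquare d c b a ↔ GcdSquare a b c d :=
  gcdSquare_congr (fun _ h => ⟨⟨h.2.2, h.2.1⟩, h.1.2, h.1.1⟩)
    (fun _ h => ⟨⟨h.2.2, h.2.1⟩, h.1.2, h.1.1⟩)

theorem gcdSquare_transpose (a b c d : ℤ) : GcdSquare a c b d ↔ GcdSquare a b c d :=
  gcdSquare_congr (fun _ h => ⟨⟨h.1.1, h.2.1⟩, h.1.2, h.2.2⟩)
    (fun _ h => ⟨⟨h.1.1, h.2.1⟩, h.1.2, h.2.2⟩)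

theorem gcdSquare_mul_right {p q r s : ℤ} (hγ : p * s - q * r = 1) (a b c d : ℤ) :
    GcdSquare (a * p + b * r) (a * q + b * s) (c * p + d * r) (c * q + d * s) ↔
      GcdSquare a b c d := by
  rw [← gcdSquare_transpose, ← gcdSquare_transpose a]
  convert gcdSquare_mul_left (p := p) (q := r) (r := q) (s := s) (by linarith) a c b d using 2 <;>
    ring_nf

theorem gcdSquare_add_mul (t a b c d : ℤ) :
    GcdSquare (a + t * c) (b + t * d) c d ↔ GcdSquare a b c d := by
  simpa using gcdSquare_mul_left (p := 1) (q := t) (r := 0) (s := 1) (by ring) a b c d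

theorem gcdSquare_neg (a b c d : ℤ) : GcdSquare a (-b) (-c) d ↔ GcdSquare a b c d := by
  simp only [GcdSquare, Int.gcd_neg, Int.neg_gcd]

/-- The rows `(a, b)`, `(c, d)` form a reduced basis of the lattice they span, `(a, b)` being the
vector nearer to the horizontal axis; generically the two vectors lie in different quadrants up to
sign, and each is longer than the other along its own axis. The four alternatives are the four ranges
of summation of `𝒯̃_n`. -/
def Reduced (a b c d : ℤ) : Prop :=
  (0 < c ∧ c < a ∧ b < 0 ∧ -b < d) ∨ (c < 0 ∧ -c < a ∧ 0 < b ∧ b < d) ∨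
    (c = 0 ∧ -d < 2 * b ∧ 2 * b ≤ d) ∨ (b = 0 ∧ c ≠ 0 ∧ -a < 2 * c ∧ 2 * c ≤ a)

/-- All matrices that occur in `𝒯̃_n`. -/
def chainIndex (n : ℕ) : Finset (ℤ × ℤ × ℤ × ℤ) :=
  ((mainIndex n ∪ (mainIndex n).image fun p => (p.1, -p.2.1, -p.2.2.1, p.2.2.2)) ∪
    upperIndex n) ∪ lowerIndex n

theorem mem_chainIndex {n : ℕ} (hn : 0 < n) {a b c d : ℤ} : (a, b, c, d) ∈ chainIndex n ↔
    a * d - b * c = (n : ℤ) ^ 2 ∧ GcdSquare a b c d ∧ Reduced a b c d := by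
  have himg : (a, b, c, d) ∈ (mainIndex n).image (fun p => (p.1, -p.2.1, -p.2.2.1, p.2.2.2)) ↔
      (a, -b, -c, d) ∈ mainIndex n := by
    rw [Finset.mem_image]
    constructor
    · rintro ⟨⟨a', b', c', d'⟩, h, he⟩
      simp only [Prod.mk.injEq] at he
      obtain ⟨rfl, rfl, rfl, rfl⟩ := he
      simpa using h
    · intro h
      exact ⟨_, h, by simp⟩
  simp only [chainIndex, Finset.mem_union, himg, mem_mainIndex, mem_upperIndex hn,
    mem_lowerIndex hn, gcdSquare_neg, Reduced]
  constructor
  · rintro (((h | h) | h) | h)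
    · exact ⟨h.1, h.2.1, Or.inl (by omega)⟩
    · exact ⟨by linarith [h.1], h.2.1, Or.inr (Or.inl (by omega))⟩
    · obtain ⟨h1, rfl, h3, h4⟩ := h
      exact ⟨by linarith, h3, Or.inr (Or.inr (Or.inl ⟨rfl, h4⟩))⟩
    · obtain ⟨h1, rfl, h3, h4, h5, h6⟩ := h
      exact ⟨by linarith, h3, Or.inr (Or.inr (Or.inr ⟨rfl, h6, h4, h5⟩))⟩
  · rintro ⟨h1, h2, h | h | ⟨rfl, h⟩ | ⟨rfl, h⟩⟩
    · exact Or.inl (Or.inl (Or.inl ⟨h1, h2, by omega⟩))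
    · exact Or.inl (Or.inl (Or.inr ⟨by linarith, h2, by omega⟩))
    · exact Or.inl (Or.inr ⟨by linarith, rfl, h2, h⟩)
    · exact Or.inr ⟨by linarith, rfl, h2, h.2.1, h.2.2, h.1⟩

/-- The four ranges of summation of `𝒯̃_n` are disjoint. -/
theorem sum_chainIndex {n : ℕ} (hn : 0 < n) {A : Type*} [AddCommGroup A]
    (q : ℤ × ℤ × ℤ × ℤ → A) : ∑ p ∈ chainIndex n, q p =
      (∑ p ∈ mainIndex n, (q p + q (p.1, -p.2.1, -p.2.2.1, p.2.2.2)))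
        + (∑ p ∈ upperIndex n, q p) + ∑ p ∈ lowerIndex n, q p := by
  rw [chainIndex, Finset.sum_union, Finset.sum_union, Finset.sum_union, Finset.sum_image,
    Finset.sum_add_distrib]
  · rintro ⟨a, b, c, d⟩ _ ⟨a', b', c', d'⟩ _ h
    simpa using h
  all_goals
    rw [Finset.disjoint_left]
    rintro ⟨a, b, c, d⟩
    simp only [Finset.mem_union, Finset.mem_image, Prod.exists, mem_mainIndex, mem_upperIndex hn,
      mem_lowerIndex hn, Prod.mk.injEq]
  · rintro h ⟨a', b', c', d', h', h2⟩
    omega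
  · rintro (h | ⟨a', b', c', d', h', h2⟩) h3 <;> omega
  · rintro ((h | ⟨a', b', c', d', h', h2⟩) | h) h3 <;> omega

/-- The successor of a basis in a chain of reduced bases: up to sign, its second vector is the
first vector of the given basis, and its first vector lies closer to the horizontal axis. -/
def nextBasis : ℤ × ℤ × ℤ × ℤ → ℤ × ℤ × ℤ × ℤ := fun (a, b, c, d) =>
  if 0 < b then (d / b * a - c, -(d % b), a, b) else (d / (-b) * a + c, d % (-b), -a, -b)

/-- Interchange of the two coordinates and of the two basis vectors. -/
def swapBasis : ℤ × ℤ × ℤ × ℤ → ℤ × ℤ × ℤ × ℤ := fun (a, b, c, d) => (d, c, b, a)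

theorem Reduced.pos {n : ℕ} (hn : 0 < n) {a b c d : ℤ} (hdet : a * d - b * c = (n : ℤ) ^ 2)
    (h : Reduced a b c d) : 0 < a ∧ 0 < d := by
  have h0 : (0 : ℤ) < (n : ℤ) ^ 2 := by positivity
  rcases h with h | h | ⟨rfl, h⟩ | ⟨rfl, h⟩
  · omega
  · omega
  · have hd : 0 < d := by omega
    exact ⟨pos_of_mul_pos_left (b := d) (by linarith) hd.le, hd⟩
  · have ha : 0 < a := by omega
    exact ⟨ha, pos_of_mul_pos_right (a := a) (by linarith) ha.le⟩

theorem swapBasis_mem {n : ℕ} (hn : 0 < n) {p : ℤ × ℤ × ℤ × ℤ} (hp : p ∈ chainIndex n) :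
    swapBasis p ∈ chainIndex n := by
  obtain ⟨a, b, c, d⟩ := p
  rw [mem_chainIndex hn] at hp
  obtain ⟨h1, h2, h3⟩ := hp
  have hpos := h3.pos hn h1
  simp only [swapBasis]
  rw [mem_chainIndex hn]
  refine ⟨by linarith, (gcdSquare_swap a b c d).2 h2, ?_⟩
  unfold Reduced at h3 ⊢
  omega

theorem nextBasis_mem {n : ℕ} (hn : 0 < n) {p : ℤ × ℤ × ℤ × ℤ} (hp : p ∈ chainIndex n)
    (hb : p.2.1 ≠ 0) : nextBasis p ∈ chainIndex n ∧ (nextBasis p).2.2.1 ≠ 0 := by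
  obtain ⟨a, b, c, d⟩ := p
  simp only at hb
  rw [mem_chainIndex hn] at hp
  obtain ⟨h1, h2, h3⟩ := hp
  obtain ⟨ha, hd⟩ := h3.pos hn h1
  simp only [nextBasis]
  split_ifs with hb0
  · have hdiv := Int.mul_ediv_add_emod d b
    have hr0 := Int.emod_nonneg d hb
    have hr1 := Int.emod_lt_of_pos d hb0
    generalize d / b = s at *
    generalize d % b = r at *
    subst hdiv
    refine ⟨(mem_chainIndex hn).2 ⟨by linear_combination h1, ?_, ?_⟩, ha.ne'⟩
    · convert (gcdSquare_mul_left (p := s) (q := -1) (r := 1) (s := 0) (by ring) a b c _).2 h2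
        using 1 <;> ring
    · have hbd : b ≤ b * s + r := by unfold Reduced at h3; omega
      have hs : 0 < s := by
        by_contra hs
        nlinarith [mul_nonneg hb0.le (by omega : 0 ≤ -s)]
      rcases hr0.eq_or_lt with rfl | hr
      · have hs2 : 2 ≤ s := by
          by_contra hs2
          obtain rfl : s = 1 := by omega
          unfold Reduced at h3
          omega
        have hc : c ≤ 0 := by unfold Reduced at h3; omega
        exact Or.inr (Or.inr (Or.inr ⟨neg_zero, ha.ne', by nlinarith, by nlinarith⟩))
      · refine Or.inl ⟨ha, ?_, by omega, by omega⟩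
        rcases h3 with h | h | h | h
        · omega
        · nlinarith
        · have hs2 : 2 ≤ s := by
            by_contra hs2
            obtain rfl : s = 1 := by omega
            omega
          nlinarith
        · omega
  · obtain ⟨β, rfl⟩ : ∃ β, b = -β := ⟨-b, by ring⟩
    have hβ : 0 < β := by omega
    rw [neg_neg]
    have hdiv := Int.mul_ediv_add_emod d β
    have hr0 := Int.emod_nonneg d hβ.ne'
    have hr1 := Int.emod_lt_of_pos d hβ
    generalize d / β = s at *
    generalize d % β = r at *
    subst hdiv
    refine ⟨(mem_chainIndex hn).2 ⟨by linear_combination h1, ?_, ?_⟩, neg_ne_zero.2 ha.ne'⟩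
    · convert (gcdSquare_mul_left (p := s) (q := 1) (r := -1) (s := 0) (by ring) a (-β) c _).2 h2
        using 1 <;> ring
    · have hbd : β ≤ β * s + r := by unfold Reduced at h3; omega
      have hs : 0 < s := by
        by_contra hs
        nlinarith [mul_nonneg hβ.le (by omega : 0 ≤ -s)]
      have hc : 0 ≤ c := by unfold Reduced at h3; omega
      rcases hr0.eq_or_lt with rfl | hr
      · refine Or.inr (Or.inr (Or.inr ⟨rfl, by omega, ?_, by nlinarith⟩))
        have hs2 : 2 ≤ s := by
          by_contra hs2
          obtain rfl : s = 1 := by omega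
          unfold Reduced at h3
          omega
        rcases hc.eq_or_lt with rfl | hc
        · have hs3 : 3 ≤ s := by
            by_contra hs3
            obtain rfl : s = 2 := by omega
            unfold Reduced at h3
            omega
          nlinarith
        · nlinarith
      · refine Or.inr (Or.inl ⟨by omega, ?_, by omega, by omega⟩)
        rcases hc.eq_or_lt with rfl | hc
        · have hs2 : 2 ≤ s := by
            by_contra hs2
            obtain rfl : s = 1 := by omega
            unfold Reduced at h3
            omega
          nlinarith
        · nlinarith

theorem swapBasis_swapBasis (p : ℤ × ℤ × ℤ × ℤ) : swapBasis (swapBasis p) = p := rfl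

/-- Walking one step back along a chain is walking one step forward after interchanging the two
coordinates. -/
theorem nextBasis_swapBasis_nextBasis {n : ℕ} (hn : 0 < n) {p : ℤ × ℤ × ℤ × ℤ}
    (hp : p ∈ chainIndex n) (hb : p.2.1 ≠ 0) :
    nextBasis (swapBasis (nextBasis p)) = swapBasis p := by
  obtain ⟨a, b, c, d⟩ := p
  simp only at hb
  rw [mem_chainIndex hn] at hp
  obtain ⟨h1, h2, h3⟩ := hp
  obtain ⟨ha, hd⟩ := h3.pos hn h1
  by_cases hb0 : 0 < b
  · have hc : 0 ≤ -c ∧ -c < a := by unfold Reduced at h3; omega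
    have e1 : (d / b * a - c) / a = d / b := by
      rw [sub_eq_add_neg, add_comm, Int.add_mul_ediv_right _ _ ha.ne',
        Int.ediv_eq_zero_of_lt hc.1 hc.2, zero_add]
    have e2 : (d / b * a - c) % a = -c := by
      rw [sub_eq_add_neg, add_comm, Int.add_mul_emod_self_right, Int.emod_eq_of_lt hc.1 hc.2]
    simp only [nextBasis, swapBasis, if_pos hb0, if_pos ha, e1, e2]
    have := Int.mul_ediv_add_emod d b
    simp only [Prod.mk.injEq, neg_neg, and_true]
    linear_combination this
  · have hc : 0 ≤ c ∧ c < a := by unfold Reduced at h3; omega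
    have e1 : (d / (-b) * a + c) / a = d / (-b) := by
      rw [add_comm, Int.add_mul_ediv_right _ _ ha.ne',
        Int.ediv_eq_zero_of_lt hc.1 hc.2, zero_add]
    have e2 : (d / (-b) * a + c) % a = c := by
      rw [add_comm, Int.add_mul_emod_self_right, Int.emod_eq_of_lt hc.1 hc.2]
    have ha' : ¬ 0 < -a := by omega
    simp only [nextBasis, swapBasis, if_neg hb0, if_neg ha', neg_neg, e1, e2]
    have := Int.mul_ediv_add_emod d (-b)
    simp only [Prod.mk.injEq, and_true]
    linear_combination this

/-- Invariance of a function of integral matrices of determinant `n²` under multiplication from the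
left by `-I` and by the matrices `(1 t; 0 1)`. Such a function depends only on the second row of the
matrix, up to sign, and on the lattice spanned by the rows. -/
structure TranslationInvariant {A : Type*} (n : ℕ) (φ : ℤ × ℤ × ℤ × ℤ → A) : Prop where
  add_mul : ∀ t a b c d : ℤ, a * d - b * c = (n : ℤ) ^ 2 →
    φ (a + t * c, b + t * d, c, d) = φ (a, b, c, d)
  neg : ∀ a b c d : ℤ, a * d - b * c = (n : ℤ) ^ 2 → φ (-a, -b, -c, -d) = φ (a, b, c, d)

section Telescoping

variable {A : Type*} {n : ℕ} {φ : ℤ × ℤ × ℤ × ℤ → A}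

/-- The second row of `nextBasis M` is `±` the first row of `M`, so that both sides depend on the
same vector of the same lattice. -/
theorem TranslationInvariant.apply_nextBasis (hφ : TranslationInvariant n φ) {a b c d : ℤ}
    (hdet : a * d - b * c = (n : ℤ) ^ 2) :
    φ (nextBasis (a, b, c, d)) = φ (-c, -d, a, b) := by
  simp only [nextBasis]
  split_ifs with hb0
  · rw [← hφ.add_mul (d / b) (-c) (-d) a b (by linarith)]
    congr 2
    · ring
    · have := Int.mul_ediv_add_emod d b
      congr 1
      linear_combination -this
  · have hd := Int.mul_ediv_add_emod d (-b)
    rw [← hφ.add_mul (-(d / (-b))) (-c) (-d) a b (by linarith),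
      ← hφ.neg (-c + -(d / (-b)) * a) _ _ _ (by linear_combination hdet)]
    refine congrArg φ (Prod.ext ?_ (Prod.ext ?_ rfl)) <;> dsimp only
    · ring
    · linear_combination hd

variable [AddCommGroup A]

/-- Passing to the successor matches the first vectors off the horizontal axis with the second
vectors off the vertical axis. -/
theorem sum_chain_succ (hn : 0 < n) (hφ : TranslationInvariant n φ) :
    ∑ p ∈ chainIndex n with p.2.1 ≠ 0, φ (-p.2.2.1, -p.2.2.2, p.1, p.2.1) =
      ∑ p ∈ chainIndex n with p.2.2.1 ≠ 0, φ p := by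
  refine Finset.sum_bij' (fun p _ => nextBasis p)
    (fun p _ => swapBasis (nextBasis (swapBasis p))) ?_ ?_ ?_ ?_ ?_
  · intro p hp
    rw [Finset.mem_filter] at hp ⊢
    exact nextBasis_mem hn hp.1 hp.2
  · intro p hp
    rw [Finset.mem_filter] at hp ⊢
    have := nextBasis_mem hn (swapBasis_mem hn hp.1) hp.2
    exact ⟨swapBasis_mem hn this.1, this.2⟩
  · intro p hp
    rw [Finset.mem_filter] at hp
    rw [nextBasis_swapBasis_nextBasis hn hp.1 hp.2, swapBasis_swapBasis]
  · intro p hp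
    rw [Finset.mem_filter] at hp
    exact nextBasis_swapBasis_nextBasis hn (swapBasis_mem hn hp.1) hp.2
  · rintro ⟨a, b, c, d⟩ hp
    rw [Finset.mem_filter, mem_chainIndex hn] at hp
    exact (hφ.apply_nextBasis hp.1.1).symm

/-- Each lattice has exactly one reduced basis whose second vector lies on the vertical axis, and
exactly one Hecke representative. -/
theorem sum_chain_last (hn : 0 < n) (hφ : TranslationInvariant n φ) :
    ∑ p ∈ chainIndex n with ¬ p.2.2.1 ≠ 0, φ p = ∑ p ∈ heckeIndex n, φ p := by
  refine Finset.sum_bij' (fun p _ => (p.1, if 0 ≤ p.2.1 then p.2.1 else p.2.1 + p.2.2.2, 0, p.2.2.2))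
    (fun p _ => (p.1, if 2 * p.2.1 ≤ p.2.2.2 then p.2.1 else p.2.1 - p.2.2.2, 0, p.2.2.2))
    ?_ ?_ ?_ ?_ ?_ <;> rintro ⟨a, b, c, d⟩ hp
  · rw [Finset.mem_filter, mem_chainIndex hn] at hp
    obtain ⟨⟨h1, h2, h3⟩, hc⟩ := hp
    obtain rfl : c = 0 := not_not.1 hc
    have hpos := h3.pos hn h1
    rw [mem_heckeIndex]
    unfold Reduced at h3
    refine ⟨by linarith, rfl, hpos.1, hpos.2, by dsimp only; omega, by dsimp only; omega, ?_⟩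
    dsimp only
    split_ifs
    · exact h2
    · simpa using (gcdSquare_add_mul 1 a b 0 d).2 h2
  · rw [mem_heckeIndex] at hp
    obtain ⟨h1, rfl, ha, hd, hb, hbd, h2⟩ := hp
    rw [Finset.mem_filter, mem_chainIndex hn]
    refine ⟨⟨by linarith, ?_, Or.inr (Or.inr (Or.inl ⟨rfl, ?_, ?_⟩))⟩, not_not.2 rfl⟩ <;> dsimp only
    · split_ifs
      · exact h2
      · simpa [sub_eq_add_neg] using (gcdSquare_add_mul (-1) a b 0 d).2 h2
    · omega
    · omega
  · rw [Finset.mem_filter, mem_chainIndex hn] at hp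
    obtain ⟨⟨h1, h2, h3⟩, hc⟩ := hp
    obtain rfl : c = 0 := not_not.1 hc
    have hpos := h3.pos hn h1
    unfold Reduced at h3
    simp only [Prod.mk.injEq, true_and, and_true]
    omega
  · rw [mem_heckeIndex] at hp
    simp only [Prod.mk.injEq, true_and, and_true]
    omega
  · rw [Finset.mem_filter, mem_chainIndex hn] at hp
    obtain ⟨⟨h1, h2, h3⟩, hc⟩ := hp
    obtain rfl : c = 0 := not_not.1 hc
    dsimp only
    split_ifs
    · rfl
    · simpa using (hφ.add_mul 1 a b 0 d h1).symm

/-- Each lattice has exactly one reduced basis whose first vector lies on the horizontal axis; it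
corresponds to a Hecke representative multiplied by `S` from the right. -/
theorem sum_chain_first (hn : 0 < n) (hφ : TranslationInvariant n φ) :
    ∑ p ∈ chainIndex n with ¬ p.2.1 ≠ 0, φ (-p.2.2.1, -p.2.2.2, p.1, p.2.1) =
      ∑ p ∈ heckeIndex n, φ (p.2.1, -p.1, p.2.2.2, -p.2.2.1) := by
  refine Finset.sum_bij'
    (fun p _ => (p.2.2.2, if p.2.2.1 ≤ 0 then -p.2.2.1 else p.1 - p.2.2.1, 0, p.1))
    (fun p _ => (p.2.2.2, 0, if 2 * p.2.1 < p.2.2.2 then -p.2.1 else p.2.2.2 - p.2.1, p.1))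
    ?_ ?_ ?_ ?_ ?_ <;> rintro ⟨a, b, c, d⟩ hp
  · rw [Finset.mem_filter, mem_chainIndex hn] at hp
    obtain ⟨⟨h1, h2, h3⟩, hc⟩ := hp
    obtain rfl : b = 0 := not_not.1 hc
    have hpos := h3.pos hn h1
    have h4 : GcdSquare d (-c) 0 a := by
      simpa using (gcdSquare_neg d c 0 a).2 ((gcdSquare_swap a 0 c d).2 h2)
    rw [mem_heckeIndex]
    unfold Reduced at h3
    refine ⟨by linarith, rfl, hpos.2, hpos.1, by dsimp only; omega, by dsimp only; omega, ?_⟩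
    dsimp only
    split_ifs
    · exact h4
    · simpa [sub_eq_neg_add] using (gcdSquare_add_mul 1 d (-c) 0 a).2 h4
  · rw [mem_heckeIndex] at hp
    obtain ⟨h1, rfl, ha, hd, hb, hbd, h2⟩ := hp
    have h4 : GcdSquare d 0 (-b) a := by
      simpa using (gcdSquare_neg d 0 b a).2 ((gcdSquare_swap a b 0 d).2 h2)
    rw [Finset.mem_filter, mem_chainIndex hn]
    refine ⟨⟨by linarith, ?_, ?_⟩, not_not.2 rfl⟩ <;> dsimp only
    · split_ifs
      · exact h4
      · rw [← gcdSquare_swap] at h4 ⊢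
        simpa [sub_eq_neg_add] using (gcdSquare_add_mul 1 a (-b) 0 d).2 h4
    · unfold Reduced
      omega
  · rw [Finset.mem_filter, mem_chainIndex hn] at hp
    obtain ⟨⟨h1, h2, h3⟩, hc⟩ := hp
    obtain rfl : b = 0 := not_not.1 hc
    have hpos := h3.pos hn h1
    unfold Reduced at h3
    simp only [Prod.mk.injEq, true_and, and_true]
    omega
  · rw [mem_heckeIndex] at hp
    simp only [Prod.mk.injEq, true_and, and_true]
    omega
  · rw [Finset.mem_filter, mem_chainIndex hn] at hp
    obtain ⟨⟨h1, h2, h3⟩, hc⟩ := hp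
    obtain rfl : b = 0 := not_not.1 hc
    dsimp only
    split_ifs
    · simp
    · simpa [sub_eq_neg_add] using (hφ.add_mul 1 (-c) (-d) a 0 (by linarith)).symm

/-- Telescoping along the chains of reduced bases: `(-c, -d; a, b)` is `SM`, and `(b, -a; d, -c)` is
`MS`. -/
theorem sum_hecke_eq_sum_chain (hn : 0 < n) (hφ : TranslationInvariant n φ) :
    ∑ p ∈ heckeIndex n, (φ (p.2.1, -p.1, p.2.2.2, -p.2.2.1) - φ p) =
      ∑ p ∈ chainIndex n, (φ (-p.2.2.1, -p.2.2.2, p.1, p.2.1) - φ p) := by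
  rw [Finset.sum_sub_distrib, Finset.sum_sub_distrib,
    ← Finset.sum_filter_add_sum_filter_not (chainIndex n) (fun p => p.2.1 ≠ 0)
      (fun p => φ (-p.2.2.1, -p.2.2.2, p.1, p.2.1)),
    ← Finset.sum_filter_add_sum_filter_not (chainIndex n) (fun p => p.2.2.1 ≠ 0) φ,
    sum_chain_succ hn hφ, sum_chain_last hn hφ, sum_chain_first hn hφ]
  abel

end Telescoping

/-! ### The period function of the image of the Hecke operator -/

theorem slash_T_zpow {k m : ℤ} {f : JFun} (hf : slash k m f (ofSLZ ModularGroup.T 0 0) = f)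
    (t : ℤ) : slash k m f (ofSLZ (ModularGroup.T ^ t) 0 0) = f := by
  have hadd (s t : ℤ) : slash k m (slash k m f (ofSLZ (ModularGroup.T ^ s) 0 0))
      (ofSLZ (ModularGroup.T ^ t) 0 0) = slash k m f (ofSLZ (ModularGroup.T ^ (s + t)) 0 0) := by
    rw [slash_ofSLZ_ofSLZ, zpow_add]; simp
  induction t using Int.induction_on with
  | zero => simpa using slash_ofSLZ_one k m f
  | succ i ih =>
    rw [← hadd, ih]
    simpa using hf
  | pred i ih =>
    have := hadd 1 (-(i : ℤ) - 1)
    rw [zpow_one, hf] at this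
    rw [this]
    simpa using ih

theorem slash_ofInt_upper {k m : ℤ} {f : JFun}
    (hf : slash k m f (ofSLZ ModularGroup.T 0 0) = f) {n : ℕ} (hn : 0 < n) {a b b' d : ℤ}
    (h : a * d = (n : ℤ) ^ 2) (hb : b ≡ b' [ZMOD d]) (X Y : ℤ) :
    slash k m f (ofInt a b 0 d X Y) = slash k m f (ofInt a b' 0 d X Y) := by
  obtain ⟨t, ht⟩ := hb.dvd
  have := slash_ofSLZ_ofInt k m f hn (show a * d - b * 0 = (n : ℤ) ^ 2 by linarith) X Y
    (ModularGroup.T ^ t)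
  rw [slash_T_zpow hf] at this
  simp only [ModularGroup.coe_T_zpow] at this
  simp only [Matrix.of_apply, Matrix.cons_val', Matrix.cons_val_zero, Matrix.cons_val_one,
    Matrix.cons_val_fin_one] at this
  rw [this, show b' = b + t * d by linarith]
  congr 2 <;> ring

theorem latticeSum_zero (k m : ℤ) (n : ℕ) (a b c d : ℤ) :
    latticeSum k m n 0 a b c d = 0 := by
  simpa using latticeSum_sub k m n 0 0 a b c d

section HeckeOperator

variable {k m : ℤ} {n : ℕ} {f P : JFun}

theorem translationInvariant_latticeSum (hinv : LatticeInvariant k m f) (hn : 0 < n)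
    (hT : slash k m f (ofSLZ ModularGroup.T 0 0) = f)
    (hI : slash k m f (ofSLZ (-1) 0 0) = f) :
    TranslationInvariant n fun p => latticeSum k m n f p.1 p.2.1 p.2.2.1 p.2.2.2 where
  add_mul t a b c d h := by
    have := hinv.slash_latticeSum hn h (ModularGroup.T ^ t) 0 0
    rw [slash_T_zpow hT, ModularGroup.coe_T_zpow] at this
    simpa using this.symm
  neg a b c d h := by
    have := hinv.slash_latticeSum hn h (-1) 0 0
    rw [hI] at this
    simpa using this.symm

theorem heckeT_slash (hinv : LatticeInvariant k m f) (hn : 0 < n) (γ : SL(2, ℤ)) (lam mu : ℤ) :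
    slash k m (heckeT k m n f) (ofSLZ γ lam mu) = (n : ℂ) ^ (k - 4) • ∑ p ∈ heckeIndex n,
      latticeSum k m n f (p.1 * γ 0 0 + p.2.1 * γ 1 0) (p.1 * γ 0 1 + p.2.1 * γ 1 1)
        (p.2.2.1 * γ 0 0 + p.2.2.2 * γ 1 0) (p.2.2.1 * γ 0 1 + p.2.2.2 * γ 1 1) := by
  rw [heckeT, slash_smul, slash_sum]
  congr 1
  refine Finset.sum_congr rfl ?_
  rintro ⟨a, b, c, d⟩ hp
  rw [mem_heckeIndex] at hp
  exact hinv.latticeSum_slash hn (by rw [hp.2.1]; linarith [hp.1]) γ lam mu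

/-- If the period function `P` of `f` is invariant under `-I`, then so is `f`: applying
`f|S = f + P` twice gives `f|(-I) = f + P + P|S`, and `-I` has order two. -/
theorem slash_neg_one (hf : LatticeInvariant k m f) (hP : LatticeInvariant k m P)
    (hfP : slash k m f elT = f + P) (hPI : slash k m P (ofSLZ (-1) 1 0) = P) :
    slash k m f (ofSLZ (-1) 0 0) = f := by
  have hmul (F : JFun) (γ γ' : SL(2, ℤ)) : slash k m (slash k m F (ofSLZ γ 0 0)) (ofSLZ γ' 0 0)
      = slash k m F (ofSLZ (γ * γ') 0 0) := by
    rw [slash_ofSLZ_ofSLZ]; simp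
  have hSS : ModularGroup.S * ModularGroup.S = -1 :=
    Subtype.ext (by simpa using ModularGroup.S_mul_S_eq)
  rw [elT, hf.slash_eq] at hfP
  rw [hP.slash_eq] at hPI
  have h1 : slash k m f (ofSLZ (-1) 0 0) = f + P + slash k m P (ofSLZ ModularGroup.S 0 0) := by
    rw [← hSS, ← hmul, hfP, slash_add, hfP]
  have h2 : slash k m (slash k m P (ofSLZ ModularGroup.S 0 0)) (ofSLZ (-1) 0 0)
      = slash k m P (ofSLZ ModularGroup.S 0 0) := by
    rw [hmul, show ModularGroup.S * (-1) = -1 * ModularGroup.S by simp, ← hmul, hPI]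
  have h3 : slash k m (slash k m f (ofSLZ (-1) 0 0)) (ofSLZ (-1) 0 0) = f := by
    rw [hmul, neg_mul_neg, one_mul, slash_ofSLZ_one]
  rw [h1, slash_add, slash_add, h2, hPI, h1] at h3
  have h4 : (2 : ℂ) • (P + slash k m P (ofSLZ ModularGroup.S 0 0)) = 0 := by
    rw [two_smul]
    linear_combination (exp := 1) h3
  have h5 := (smul_eq_zero.1 h4).resolve_left two_ne_zero
  rw [h1, add_assoc, h5, add_zero]

theorem latticeInvariant_period (hf : LatticeInvariant k m f) (hfP : slash k m f elT = f + P) :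
    LatticeInvariant k m P := by
  have h : P = slash k m f elT - f := by rw [hfP]; abel
  exact h ▸ (hf.slash _ _ _).sub hf

/-- With `φ(M) = ∑ f|[M, (X, Y)]`, the period function of `f|T_n^∞` is the sum of `φ(MS) - φ(M)` over
the Hecke representatives, and `∑ P|[M, (X, Y)] = φ(SM) - φ(M)`; the two sums agree by telescoping
along the chains of reduced bases. -/
theorem period_heckeT (hn : 0 < n) (hf : LatticeInvariant k m f)
    (hT : slash k m f (ofSLZ ModularGroup.T 0 0) = f) (hfP : slash k m f elT = f + P)
    (hPI : slash k m P (ofSLZ (-1) 1 0) = P) :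
    slash k m (heckeT k m n f) elT - heckeT k m n f = (n : ℂ) ^ (k - 4) • tildeT k m n P := by
  have hPeq : P = slash k m f elT - f := by rw [hfP]; abel
  have hP := latticeInvariant_period hf hfP
  have hφ := translationInvariant_latticeSum hf hn hT (slash_neg_one hf hP hfP hPI)
  have hψ {a b c d : ℤ} (h : a * d - b * c = (n : ℤ) ^ 2) : latticeSum k m n P a b c d =
      latticeSum k m n f (-c) (-d) a b - latticeSum k m n f a b c d := by
    rw [hPeq, latticeSum_sub, elT, hf.slash_latticeSum hn h]
    simp [ModularGroup.S]
  rw [elT, heckeT_slash hf hn, heckeT, ← smul_sub, ← Finset.sum_sub_distrib]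
  congr 1
  have h1 := sum_hecke_eq_sum_chain hn hφ
  dsimp only at h1
  have h2 := sum_chainIndex hn fun p : ℤ × ℤ × ℤ × ℤ =>
    latticeSum k m n P p.1 p.2.1 p.2.2.1 p.2.2.2
  rw [tildeT, ← h2]
  refine Eq.trans ?_ (h1.trans ?_)
  · simp [ModularGroup.S]
  · refine Finset.sum_congr rfl ?_
    rintro ⟨a, b, c, d⟩ hp
    exact (hψ ((mem_chainIndex hn).1 hp).1).symm

/-! ### Right translation of the Hecke cosets -/

/-- A quadruple of integers, as a matrix. -/
def toMat (p : ℤ × ℤ × ℤ × ℤ) : Matrix (Fin 2) (Fin 2) ℤ := !![p.1, p.2.1; p.2.2.1, p.2.2.2]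

/-- Hermite normal form: every left coset of `SL₂(ℤ)` in the matrices of determinant `n²` with
square content is represented in `heckeIndex n`. -/
theorem exists_hecke_rep (hn : 0 < n) {A B C D : ℤ} (hdet : A * D - B * C = (n : ℤ) ^ 2)
    (hg : GcdSquare A B C D) :
    ∃ p ∈ heckeIndex n, ∃ δ : SL(2, ℤ), !![A, B; C, D] = (δ : Matrix (Fin 2) (Fin 2) ℤ) * toMat p := by
  have h0 : (0 : ℤ) < (n : ℤ) ^ 2 := by positivity
  have hg0 : 0 < Int.gcd A C := by
    refine Nat.pos_of_ne_zero fun h => ?_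
    rw [Int.gcd_eq_zero_iff] at h
    rw [h.1, h.2] at hdet
    linarith
  have hbez := Int.gcd_eq_gcd_ab A C
  obtain ⟨A', hA⟩ : ∃ A', A = (Int.gcd A C : ℤ) * A' := Int.gcd_dvd_left ..
  obtain ⟨C', hC⟩ : ∃ C', C = (Int.gcd A C : ℤ) * C' := Int.gcd_dvd_right ..
  generalize Int.gcdA A C = u at hbez
  generalize Int.gcdB A C = v at hbez
  have hgpos : (0 : ℤ) < (Int.gcd A C : ℤ) := by exact_mod_cast hg0
  generalize (Int.gcd A C : ℤ) = g at *
  have huv : u * A' + v * C' = 1 := by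
    have : g * (u * A' + v * C') = g * 1 := by
      rw [hA, hC] at hbez; linarith
    exact mul_left_cancel₀ hgpos.ne' this
  have hd : g * (A' * D - C' * B) = (n : ℤ) ^ 2 := by rw [hA, hC] at hdet; linarith
  have hdpos : 0 < A' * D - C' * B := pos_of_mul_pos_right (a := g) (by linarith) hgpos.le
  have hb := Int.mul_ediv_add_emod (u * B + v * D) (A' * D - C' * B)
  have hb0 := Int.emod_nonneg (u * B + v * D) hdpos.ne'
  have hb1 := Int.emod_lt_of_pos (u * B + v * D) hdpos
  generalize (u * B + v * D) / (A' * D - C' * B) = t at *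
  generalize (u * B + v * D) % (A' * D - C' * B) = b at *
  -- `b` is the upper right entry `uB + vD` reduced modulo the lower right entry.
  have eB : B = (A' * b + (A' * t - v) * (A' * D - C' * B)) := by
    linear_combination -A' * hb - B * huv
  have eD : D = (C' * b + (C' * t + u) * (A' * D - C' * B)) := by
    linear_combination -C' * hb - D * huv
  have hδ : A' * (C' * t + u) - (A' * t - v) * C' = 1 := by linear_combination huv
  refine ⟨(g, b, 0, A' * D - C' * B), ?_, ⟨!![A', A' * t - v; C', C' * t + u], ?_⟩, ?_⟩
  · rw [mem_heckeIndex]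
    refine ⟨hd, rfl, hgpos, hdpos, hb0, hb1, ?_⟩
    rw [← gcdSquare_mul_left hδ]
    convert hg using 1 <;> linarith
  · rw [Matrix.det_fin_two_of]; exact hδ
  · ext i j
    fin_cases i <;> fin_cases j <;> simp [toMat, Matrix.mul_apply] <;> linarith

/-- An element of `SL₂(ℤ)` between two elements of `heckeIndex n` is upper unipotent. -/
theorem hecke_unipotent {p q : ℤ × ℤ × ℤ × ℤ} (hp : p ∈ heckeIndex n) {δ : SL(2, ℤ)}
    (hq : 0 < q.1 ∧ q.2.2.1 = 0) (h : toMat q = (δ : Matrix (Fin 2) (Fin 2) ℤ) * toMat p) :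
    δ 0 0 = 1 ∧ δ 1 0 = 0 ∧ δ 1 1 = 1 := by
  obtain ⟨a, b, c, d⟩ := p
  obtain ⟨a', b', c', d'⟩ := q
  rw [mem_heckeIndex] at hp
  obtain ⟨-, rfl, ha, -⟩ := hp
  have h00 := congrFun (congrFun h 0) 0
  have h10 := congrFun (congrFun h 1) 0
  simp only at hq
  simp [toMat, Matrix.mul_apply, hq.2, ha.ne'] at h00 h10
  have hdet := det_eq_one δ
  rw [h10, mul_zero, sub_zero] at hdet
  have hpos : 0 < δ 0 0 := pos_of_mul_pos_left (b := a) (by linarith [hq.1]) ha.le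
  have h1 : δ 0 0 = 1 := by
    rcases Int.eq_one_or_neg_one_of_mul_eq_one hdet with h | h <;> omega
  exact ⟨h1, h10, by rwa [h1, one_mul] at hdet⟩

theorem hecke_rep_unique {p q : ℤ × ℤ × ℤ × ℤ} (hp : p ∈ heckeIndex n) (hq : q ∈ heckeIndex n)
    {δ : SL(2, ℤ)} (h : toMat q = (δ : Matrix (Fin 2) (Fin 2) ℤ) * toMat p) : q = p := by
  obtain ⟨a, b, c, d⟩ := p
  obtain ⟨a', b', c', d'⟩ := q
  have hq' := mem_heckeIndex.1 hq
  have hp' := mem_heckeIndex.1 hp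
  obtain ⟨h1, h2, h3⟩ := hecke_unipotent hp ⟨hq'.2.2.1, hq'.2.1⟩ h
  obtain ⟨-, rfl, ha', hd', hb', hbd', -⟩ := hq'
  obtain ⟨-, rfl, ha, hd, hb, hbd, -⟩ := hp'
  have h00 := congrFun (congrFun h 0) 0
  have h01 := congrFun (congrFun h 0) 1
  have h11 := congrFun (congrFun h 1) 1
  simp [toMat, Matrix.mul_apply, h1, h2, h3] at h00 h01 h11
  subst h00 h11
  have h4 : δ 0 1 = 0 := by
    have : δ 0 1 < 1 := by
      by_contra hc
      nlinarith
    have : -1 < δ 0 1 := by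
      by_contra hc
      nlinarith
    omega
  rw [h4] at h01
  simp [h01]

/-- Right multiplication by `γ ∈ SL₂(ℤ)` permutes the cosets represented by `heckeIndex n`. -/
theorem exists_hecke_perm (hn : 0 < n) (γ : SL(2, ℤ)) :
    ∃ (σ : ℤ × ℤ × ℤ × ℤ → ℤ × ℤ × ℤ × ℤ) (δ : ℤ × ℤ × ℤ × ℤ → SL(2, ℤ)),
      (∀ p ∈ heckeIndex n, σ p ∈ heckeIndex n ∧
        toMat p * (γ : Matrix (Fin 2) (Fin 2) ℤ) = (δ p : Matrix (Fin 2) (Fin 2) ℤ) * toMat (σ p)) ∧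
      ∀ q : ℤ × ℤ × ℤ × ℤ → JFun, ∑ p ∈ heckeIndex n, q (σ p) = ∑ p ∈ heckeIndex n, q p := by
  have h (p : ℤ × ℤ × ℤ × ℤ) (hp : p ∈ heckeIndex n) : ∃ q ∈ heckeIndex n, ∃ δ : SL(2, ℤ),
      toMat p * (γ : Matrix (Fin 2) (Fin 2) ℤ) = (δ : Matrix (Fin 2) (Fin 2) ℤ) * toMat q := by
    obtain ⟨a, b, c, d⟩ := p
    obtain ⟨h1, rfl, -, -, -, -, hg⟩ := mem_heckeIndex.1 hp
    obtain ⟨q, hq, δ, hδ⟩ := exists_hecke_rep hn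
      (det_mul_right γ (show a * d - b * 0 = (n : ℤ) ^ 2 by linarith))
      ((gcdSquare_mul_right (det_eq_one γ) a b 0 d).2 hg)
    refine ⟨q, hq, δ, hδ ▸ ?_⟩
    ext i j
    fin_cases i <;> fin_cases j <;> simp [toMat, Matrix.mul_apply]
  choose! σ hσ δ hδ using h
  refine ⟨σ, δ, fun p hp => ⟨hσ p hp, hδ p hp⟩, fun q => ?_⟩
  have hinj : Set.InjOn σ (heckeIndex n) := by
    intro p hp p' hp' he
    have e1 := hδ p hp
    have e2 := hδ p' hp'
    rw [he] at e1
    refine (hecke_rep_unique hp hp' (δ := δ p' * (δ p)⁻¹) ?_).symm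
    have hγ : (γ : Matrix (Fin 2) (Fin 2) ℤ) * ((γ⁻¹ : SL(2, ℤ)) : Matrix (Fin 2) (Fin 2) ℤ) = 1 := by
      rw [← Matrix.SpecialLinearGroup.coe_mul, mul_inv_cancel, Matrix.SpecialLinearGroup.coe_one]
    have hδ' : (((δ p)⁻¹ : SL(2, ℤ)) : Matrix (Fin 2) (Fin 2) ℤ) * (δ p : Matrix (Fin 2) (Fin 2) ℤ) = 1 := by
      rw [← Matrix.SpecialLinearGroup.coe_mul, inv_mul_cancel, Matrix.SpecialLinearGroup.coe_one]
    calc toMat p' = toMat p' * (γ : Matrix (Fin 2) (Fin 2) ℤ) * ((γ⁻¹ : SL(2, ℤ)) : Matrix (Fin 2) (Fin 2) ℤ) := by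
          rw [mul_assoc, hγ, mul_one]
      _ = (δ p' : Matrix (Fin 2) (Fin 2) ℤ) * ((((δ p)⁻¹ : SL(2, ℤ)) : Matrix (Fin 2) (Fin 2) ℤ) * (δ p : Matrix (Fin 2) (Fin 2) ℤ))
            * toMat (σ p') * ((γ⁻¹ : SL(2, ℤ)) : Matrix (Fin 2) (Fin 2) ℤ) := by rw [e2, hδ', mul_one]
      _ = ((δ p' * (δ p)⁻¹ : SL(2, ℤ)) : Matrix (Fin 2) (Fin 2) ℤ)
            * (toMat p * (γ : Matrix (Fin 2) (Fin 2) ℤ) * ((γ⁻¹ : SL(2, ℤ)) : Matrix (Fin 2) (Fin 2) ℤ)) := by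
          rw [e1, Matrix.SpecialLinearGroup.coe_mul]; simp only [mul_assoc]
      _ = _ := by rw [mul_assoc (toMat p), hγ, mul_one]
  exact Finset.sum_nbij σ hσ hinj
    (Finset.surjOn_of_injOn_of_card_le σ hσ hinj le_rfl) fun _ _ => rfl

/-- The failure of invariance of `f|T_n^∞` is a sum of transforms of those of `f`. -/
theorem heckeT_slash_sub (hf : LatticeInvariant k m f) (hn : 0 < n) (γ : SL(2, ℤ)) (lam mu : ℤ)
    {σ : ℤ × ℤ × ℤ × ℤ → ℤ × ℤ × ℤ × ℤ} {δ : ℤ × ℤ × ℤ × ℤ → SL(2, ℤ)}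
    (hσ : ∀ p ∈ heckeIndex n, σ p ∈ heckeIndex n ∧
        toMat p * (γ : Matrix (Fin 2) (Fin 2) ℤ) = (δ p : Matrix (Fin 2) (Fin 2) ℤ) * toMat (σ p))
    (hsum : ∀ q : ℤ × ℤ × ℤ × ℤ → JFun,
      ∑ p ∈ heckeIndex n, q (σ p) = ∑ p ∈ heckeIndex n, q p) :
    slash k m (heckeT k m n f) (ofSLZ γ lam mu) - heckeT k m n f =
      (n : ℂ) ^ (k - 4) • ∑ p ∈ heckeIndex n,
        latticeSum k m n (slash k m f (ofSLZ (δ p) 0 0) - f)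
          (σ p).1 (σ p).2.1 (σ p).2.2.1 (σ p).2.2.2 := by
  rw [heckeT_slash hf hn, heckeT, ← smul_sub,
    ← hsum fun p => latticeSum k m n f p.1 p.2.1 p.2.2.1 p.2.2.2, ← Finset.sum_sub_distrib]
  congr 1
  refine Finset.sum_congr rfl fun p hp => ?_
  obtain ⟨h1, h2⟩ := hσ p hp
  generalize σ p = q at h1 h2 ⊢
  generalize δ p = δ at h2 ⊢
  obtain ⟨a, b, c, d⟩ := p
  obtain ⟨a', b', c', d'⟩ := q
  obtain ⟨h3, rfl, -⟩ := mem_heckeIndex.1 h1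
  rw [latticeSum_sub, hf.slash_latticeSum hn (by linarith)]
  have e (i j : Fin 2) := congrFun (congrFun h2 i) j
  have e00 := e 0 0
  have e01 := e 0 1
  have e10 := e 1 0
  have e11 := e 1 1
  simp only [toMat, Matrix.mul_apply, Fin.sum_univ_two, Matrix.of_apply, Matrix.cons_val',
    Matrix.cons_val_zero, Matrix.cons_val_one, Matrix.cons_val_fin_one] at e00 e01 e10 e11
  rw [e00, e01, e10, e11]

theorem heckeT_slash_lattice (hf : LatticeInvariant k m f) (hn : 0 < n) (lam mu : ℤ) :
    slash k m (heckeT k m n f) (ofSLZ 1 lam mu) = heckeT k m n f := by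
  rw [heckeT_slash hf hn]
  simp [heckeT]

theorem heckeT_slash_T (hf : LatticeInvariant k m f) (hn : 0 < n)
    (hT : slash k m f (ofSLZ ModularGroup.T 0 0) = f) :
    slash k m (heckeT k m n f) (ofSLZ ModularGroup.T 0 0) = heckeT k m n f := by
  obtain ⟨σ, δ, hσ, hsum⟩ := exists_hecke_perm hn ModularGroup.T
  rw [← sub_eq_zero, heckeT_slash_sub hf hn _ _ _ hσ hsum, Finset.sum_eq_zero, smul_zero]
  intro p hp
  obtain ⟨h1, h2⟩ := hσ p hp
  obtain ⟨a, b, c, d⟩ := p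
  obtain ⟨-, rfl, ha, -⟩ := mem_heckeIndex.1 hp
  obtain ⟨u1, u2, u3⟩ := hecke_unipotent h1 (q := (a, a + b, 0, d)) ⟨ha, rfl⟩ (by
    rw [← h2]
    ext i j
    fin_cases i <;> fin_cases j <;> simp [toMat, Matrix.mul_apply, ModularGroup.T])
  have e : δ (a, b, 0, d) = ModularGroup.T ^ (δ (a, b, 0, d) 0 1) := by
    ext i j
    rw [ModularGroup.coe_T_zpow]
    fin_cases i <;> fin_cases j <;> simp [u1, u2, u3]
  rw [e, slash_T_zpow hT, sub_self, latticeSum_zero]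

end HeckeOperator

/-! ### Analyticity -/

/-- The factor by which the action of `g` multiplies, as a function on `ℂ × ℂ`. -/
def factor (k m : ℤ) (g : RealJacobi) (p : ℂ × ℂ) : ℂ :=
  (g.zeta : ℂ) ^ m * ((g.mat 1 0 : ℂ) * p.1 + (g.mat 1 1 : ℂ)) ^ (-k) *
    Complex.exp (2 * (Real.pi : ℂ) * Complex.I * (m : ℂ) *
      (-((g.mat 1 0 : ℂ) * (p.2 + (g.lam : ℂ) * p.1 + (g.mu : ℂ)) ^ 2 /
          ((g.mat 1 0 : ℂ) * p.1 + (g.mat 1 1 : ℂ)))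
        + (g.lam : ℂ) ^ 2 * p.1 + 2 * (g.lam : ℂ) * p.2 + (g.lam : ℂ) * (g.mu : ℂ)))

/-- The action of `g` on the points of `ℍ × ℂ`, as a map on `ℂ × ℂ`. -/
def move (g : RealJacobi) (p : ℂ × ℂ) : ℂ × ℂ :=
  (((g.mat 0 0 : ℂ) * p.1 + (g.mat 0 1 : ℂ)) / ((g.mat 1 0 : ℂ) * p.1 + (g.mat 1 1 : ℂ)),
    (p.2 + (g.lam : ℂ) * p.1 + (g.mu : ℂ)) / ((g.mat 1 0 : ℂ) * p.1 + (g.mat 1 1 : ℂ)))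

theorem isOpen_domain : IsOpen domain :=
  isOpen_lt continuous_const (Complex.continuous_im.comp continuous_fst)

theorem move_mem {g : RealJacobi} {p : ℂ × ℂ} (hp : p ∈ domain) : move g p ∈ domain := by
  have := (g.mat • (⟨p.1, hp⟩ : ℍ)).im_pos
  rwa [← UpperHalfPlane.coe_im, coe_smul] at this

theorem extend_slash {k m : ℤ} {F : JFun} {g : RealJacobi} {p : ℂ × ℂ} (hp : p ∈ domain) :
    extend (slash k m F g) p = factor k m g p * extend F (move g p) := by
  obtain ⟨t, z⟩ := p
  obtain ⟨τ, rfl⟩ : ∃ τ : ℍ, t = τ := ⟨⟨t, hp⟩, rfl⟩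
  simp only [extend, move, ← coe_smul, UpperHalfPlane.ofComplex_apply]
  rfl

theorem extend_slash_eventuallyEq {k m : ℤ} {F : JFun} {g : RealJacobi} {p : ℂ × ℂ}
    (hp : p ∈ domain) :
    (fun q => factor k m g q * extend F (move g q)) =ᶠ[𝓝 p] extend (slash k m F g) := by
  filter_upwards [isOpen_domain.mem_nhds hp] with q hq
  exact (extend_slash hq).symm

theorem analyticAt_factor {k m : ℤ} {g : RealJacobi} {p : ℂ × ℂ} (hp : p ∈ domain) :
    AnalyticAt ℂ (factor k m g) p := by
  have hj := denom_ne_zero g.mat hp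
  have hfst : AnalyticAt ℂ (fun q : ℂ × ℂ => q.1) p := analyticAt_fst
  have hsnd : AnalyticAt ℂ (fun q : ℂ × ℂ => q.2) p := analyticAt_snd
  have h1 : AnalyticAt ℂ (fun q : ℂ × ℂ => (g.mat 1 0 : ℂ) * q.1 + (g.mat 1 1 : ℂ)) p := by
    fun_prop
  unfold factor
  refine AnalyticAt.mul (analyticAt_const.mul (h1.zpow hj)) (AnalyticAt.cexp ?_)
  refine analyticAt_const.mul (AnalyticAt.add (AnalyticAt.add (AnalyticAt.add
    (AnalyticAt.neg (AnalyticAt.div (by fun_prop) h1 hj)) ?_) ?_) ?_) <;> fun_prop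

theorem analyticAt_move {g : RealJacobi} {p : ℂ × ℂ} (hp : p ∈ domain) :
    AnalyticAt ℂ (move g) p := by
  have hj := denom_ne_zero g.mat hp
  have hfst : AnalyticAt ℂ (fun q : ℂ × ℂ => q.1) p := analyticAt_fst
  have hsnd : AnalyticAt ℂ (fun q : ℂ × ℂ => q.2) p := analyticAt_snd
  exact AnalyticAt.prod (AnalyticAt.div (by fun_prop) (by fun_prop) hj)
    (AnalyticAt.div (by fun_prop) (by fun_prop) hj)

theorem analyticOnNhd_slash {k m : ℤ} {F : JFun} (g : RealJacobi)
    (hF : AnalyticOnNhd ℝ (extend F) domain) :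
    AnalyticOnNhd ℝ (extend (slash k m F g)) domain := fun _ hp =>
  ((analyticAt_factor hp).restrictScalars.mul
    ((hF _ (move_mem hp)).comp (analyticAt_move hp).restrictScalars)).congr
      (extend_slash_eventuallyEq hp)

theorem differentiableOn_slash {k m : ℤ} {F : JFun} (g : RealJacobi)
    (hF : DifferentiableOn ℂ (extend F) domain) :
    DifferentiableOn ℂ (extend (slash k m F g)) domain := fun _ hp =>
  (((analyticAt_factor hp).differentiableAt.mul
    ((hF.differentiableAt (isOpen_domain.mem_nhds (move_mem hp))).comp _
      (analyticAt_move hp).differentiableAt)).congr_of_eventuallyEq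
        (extend_slash_eventuallyEq hp).symm).differentiableWithinAt

/-! ### Growth -/

/-- The imaginary part of the exponent of the automorphy factor is the change of `y² / v`. -/
theorem im_exponent {c d lam mu : ℝ} {t : ℂ} (ht : 0 < t.im) (z : ℂ)
    (hj : (c : ℂ) * t + d ≠ 0) :
    (-((c : ℂ) * (z + lam * t + mu) ^ 2 / (c * t + d)) + (lam : ℂ) ^ 2 * t
      + 2 * lam * z + lam * mu).im + z.im ^ 2 / t.im =
    ((z + lam * t + mu) / (c * t + d)).im ^ 2 / (t.im / Complex.normSq (c * t + d)) := by
  have h0 : Complex.normSq ((c : ℂ) * t + d) ≠ 0 := fun h => hj (Complex.normSq_eq_zero.1 h)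
  obtain ⟨p, q⟩ := z
  obtain ⟨x, v⟩ := t
  have hv : v ≠ 0 := ht.ne'
  obtain ⟨D, hD⟩ : ∃ D : ℝ, D = (c * x + d) ^ 2 + (c * v) ^ 2 := ⟨_, rfl⟩
  have e : Complex.normSq ((c : ℂ) * ⟨x, v⟩ + d) = D := by
    simp [Complex.normSq_apply, hD]; ring
  rw [e] at h0
  simp only [Complex.div_im, Complex.add_im, Complex.neg_im, e]
  simp [pow_two]
  field_simp
  rw [hD]
  ring

theorem im_smul (g : SL(2, ℝ)) (τ : ℍ) : (g • τ).im =
    τ.im / Complex.normSq ((g 1 0 : ℂ) * τ + (g 1 1 : ℂ)) := by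
  rw [← UpperHalfPlane.coe_im, coe_smul, Complex.div_im, ← sub_div]
  congr 1
  have := det_eq_one g
  simp
  linear_combination τ.im * this

/-- The function `‖F‖ e^{-2π m y² / v}` is multiplied by `|cτ + d|^{-k}` under the action. -/
theorem norm_slash_mul_exp (k m : ℤ) (F : JFun) (g : RealJacobi) (τ : ℍ) (z : ℂ) :
    ‖slash k m F g τ z‖ * Real.exp (-(2 * Real.pi * m * z.im ^ 2 / τ.im)) =
      ‖(g.mat 1 0 : ℂ) * τ + (g.mat 1 1 : ℂ)‖ ^ (-k) *
        (‖F (g.mat • τ) (move g (τ, z)).2‖ *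
          Real.exp (-(2 * Real.pi * m * (move g (τ, z)).2.im ^ 2 / (g.mat • τ).im))) := by
  have hj := denom_ne_zero g.mat τ.im_pos
  have e := im_exponent (lam := g.lam) (mu := g.mu) (t := τ) τ.im_pos z hj
  have hexp (w : ℂ) : ‖Complex.exp (2 * (Real.pi : ℂ) * Complex.I * (m : ℂ) * w)‖
      = Real.exp (-(2 * Real.pi * m * w.im)) := by
    rw [Complex.norm_exp]
    simp
  rw [im_smul, move]
  dsimp only
  rw [← UpperHalfPlane.coe_im, mul_div_assoc, mul_div_assoc, ← e]
  simp only [slash, norm_mul, norm_zpow, Circle.norm_coe, one_zpow, one_mul, hexp]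
  rw [mul_add, neg_add, Real.exp_add]
  ring

/-- A measure of the distance to the boundary of the upper half plane; functions of moderate
growth are those bounded by its powers. -/
def height (τ : ℍ) : ℝ := ‖(τ : ℂ)‖ + τ.im⁻¹

theorem two_le_height (τ : ℍ) : 2 ≤ height τ := by
  have h1 : τ.im ≤ ‖(τ : ℂ)‖ := (le_abs_self _).trans (Complex.abs_im_le_norm (τ : ℂ))
  have h2 := τ.im_pos
  have h3 : τ.im * τ.im⁻¹ = 1 := mul_inv_cancel₀ h2.ne'
  have h4 := inv_pos.2 h2
  unfold height
  nlinarith [sq_nonneg (τ.im - τ.im⁻¹)]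

/-- The two-parameter bound in the definition of `𝒫_m` amounts to a bound by a power of the
height. -/
theorem mem_periodModule_iff {m : ℤ} {F : JFun} :
    F ∈ periodModule m ↔ DifferentiableOn ℂ (extend F) domain ∧ ∃ (C : ℝ) (N : ℕ), 0 ≤ C ∧
      ∀ (τ : ℍ) (z : ℂ), ‖F τ z‖ * Real.exp (-(2 * Real.pi * m * z.im ^ 2 / τ.im)) ≤
        C * height τ ^ N := by
  refine and_congr_right fun _ => ⟨?_, ?_⟩
  · rintro ⟨K, ρ, σ, hK, hρ, hσ, h⟩
    refine ⟨2 * K, ⌈max ρ σ⌉₊, by positivity, fun τ z => ?_⟩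
    rw [Real.exp_neg, ← div_eq_mul_inv, div_le_iff₀ (Real.exp_pos _)]
    refine (h τ z).le.trans (mul_le_mul_of_nonneg_right ?_ (Real.exp_pos _).le)
    have hv := inv_pos.2 τ.im_pos
    have h1 : 1 ≤ height τ := by linarith [two_le_height τ]
    have hN := Nat.le_ceil (max ρ σ)
    have h2 : ‖(τ : ℂ)‖ ^ ρ ≤ height τ ^ ⌈max ρ σ⌉₊ := by
      refine (Real.rpow_le_rpow (norm_nonneg _) (?_ : _ ≤ height τ) hρ.le).trans ?_
      · rw [height]; linarith
      · rw [← Real.rpow_natCast]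
        exact Real.rpow_le_rpow_of_exponent_le h1 ((le_max_left _ _).trans hN)
    have h3 : τ.im ^ (-σ) ≤ height τ ^ ⌈max ρ σ⌉₊ := by
      rw [Real.rpow_neg τ.im_pos.le, ← Real.inv_rpow τ.im_pos.le]
      refine (Real.rpow_le_rpow hv.le (?_ : _ ≤ height τ) hσ.le).trans ?_
      · rw [height]; linarith [norm_nonneg (τ : ℂ)]
      · rw [← Real.rpow_natCast]
        exact Real.rpow_le_rpow_of_exponent_le h1 ((le_max_right _ _).trans hN)
    nlinarith
  · rintro ⟨C, N, hC, h⟩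
    refine ⟨(C + 1) * 2 ^ N, (N + 1 : ℕ), (N + 1 : ℕ), by positivity, by positivity,
      by positivity, fun τ z => ?_⟩
    have h1 := two_le_height τ
    have h2 := h τ z
    rw [Real.exp_neg, ← div_eq_mul_inv, div_le_iff₀ (Real.exp_pos _)] at h2
    refine h2.trans_lt (mul_lt_mul_of_pos_right ?_ (Real.exp_pos _))
    rw [Real.rpow_neg τ.im_pos.le, ← Real.inv_rpow τ.im_pos.le, Real.rpow_natCast,
      Real.rpow_natCast]
    have h3 : height τ ^ (N + 1) ≤ 2 ^ N * (‖(τ : ℂ)‖ ^ (N + 1) + τ.im⁻¹ ^ (N + 1)) := by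
      simpa [height] using add_pow_le (norm_nonneg (τ : ℂ)) (inv_pos.2 τ.im_pos).le (N + 1)
    have h4 : 0 < height τ ^ N := by positivity
    calc C * height τ ^ N
      _ < (C + 1) * height τ ^ (N + 1) := by
        rw [pow_succ]
        nlinarith [mul_nonneg (mul_nonneg hC h4.le) (by linarith : 0 ≤ height τ - 1)]
      _ ≤ _ := by rw [mul_assoc]; gcongr

theorem periodModule_zero (m : ℤ) : (0 : JFun) ∈ periodModule m := by
  rw [mem_periodModule_iff]
  refine ⟨differentiableOn_const 0, 0, 0, le_rfl, fun τ z => ?_⟩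
  simp

theorem periodModule_add {m : ℤ} {F G : JFun} (hF : F ∈ periodModule m)
    (hG : G ∈ periodModule m) : F + G ∈ periodModule m := by
  rw [mem_periodModule_iff] at *
  obtain ⟨h1, C, N, hC, h2⟩ := hF
  obtain ⟨h3, D, M, hD, h4⟩ := hG
  refine ⟨h1.add h3, C + D, max N M, by positivity, fun τ z => ?_⟩
  have h1 : 1 ≤ height τ := by linarith [two_le_height τ]
  calc _ ≤ (‖F τ z‖ + ‖G τ z‖) * Real.exp (-(2 * Real.pi * m * z.im ^ 2 / τ.im)) := by
        gcongr
        exact norm_add_le _ _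
    _ ≤ C * height τ ^ N + D * height τ ^ M := by
        rw [add_mul]; exact add_le_add (h2 τ z) (h4 τ z)
    _ ≤ C * height τ ^ max N M + D * height τ ^ max N M := by
        gcongr
        · exact le_max_left _ _
        · exact le_max_right _ _
    _ = _ := by ring

theorem periodModule_smul {m : ℤ} {F : JFun} (s : ℂ) (hF : F ∈ periodModule m) :
    s • F ∈ periodModule m := by
  rw [mem_periodModule_iff] at *
  obtain ⟨h1, C, N, hC, h2⟩ := hF
  refine ⟨h1.const_smul s, ‖s‖ * C, N, by positivity, fun τ z => ?_⟩
  simp only [Pi.smul_apply, norm_smul]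
  rw [mul_assoc ‖s‖, mul_assoc ‖s‖]
  exact mul_le_mul_of_nonneg_left (h2 τ z) (norm_nonneg s)

theorem periodModule_sum {m : ℤ} {ι : Type*} {s : Finset ι} {F : ι → JFun}
    (hF : ∀ i ∈ s, F i ∈ periodModule m) : ∑ i ∈ s, F i ∈ periodModule m :=
  Finset.sum_induction _ _ (fun _ _ => periodModule_add) (periodModule_zero m) hF

/-- Moderate growth is preserved by the action of `SL₂(ℝ)`: `|cτ + d|^{±1}` and the height of `gτ`
are bounded by powers of the height of `τ`. -/
theorem exists_height_bound (g : SL(2, ℝ)) : ∃ A : ℝ, 0 ≤ A ∧ ∀ τ : ℍ,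
    ‖(g 1 0 : ℂ) * τ + (g 1 1 : ℂ)‖ ≤ A * height τ ∧
    ‖(g 1 0 : ℂ) * τ + (g 1 1 : ℂ)‖⁻¹ ≤ A * height τ ∧
    height (g • τ) ≤ A * height τ ^ 3 := by
  -- If `c ≠ 0` then `|cτ + d| ≥ |c| v`; if `c = 0` then `|cτ + d| = |d|`.
  set A₁ := |g 1 0| + |g 1 1|
  set A₂ := |g 1 0|⁻¹ + |g 1 1|⁻¹
  set A₃ := (|g 0 0| + |g 0 1|) * A₂ + A₁ ^ 2
  have hA₁ : 0 ≤ A₁ := by positivity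
  have hA₂ : 0 ≤ A₂ := by positivity
  have hA₃ : 0 ≤ A₃ := by positivity
  refine ⟨A₁ + A₂ + A₃, by positivity, fun τ => ?_⟩
  have hH : 1 ≤ height τ := by linarith [two_le_height τ]
  have hv := τ.im_pos
  have hv' := inv_pos.2 hv
  have hτ : ‖(τ : ℂ)‖ ≤ height τ := by rw [height]; linarith
  have hi : τ.im⁻¹ ≤ height τ := by rw [height]; linarith [norm_nonneg (τ : ℂ)]
  have hlin (x y : ℝ) : ‖(x : ℂ) * τ + y‖ ≤ (|x| + |y|) * height τ := by
    refine (norm_add_le _ _).trans ?_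
    rw [norm_mul, Complex.norm_real, Complex.norm_real, Real.norm_eq_abs, Real.norm_eq_abs,
      add_mul]
    gcongr
    exact le_mul_of_one_le_right (abs_nonneg y) hH
  have b1 : ‖(g 1 0 : ℂ) * τ + (g 1 1 : ℂ)‖ ≤ A₁ * height τ := hlin _ _
  have b2 : ‖(g 1 0 : ℂ) * τ + (g 1 1 : ℂ)‖⁻¹ ≤ A₂ * height τ := by
    rw [add_mul]
    by_cases hc : g 1 0 = 0
    · -- Here `|c|⁻¹ = 0`, and the summand `|d|⁻¹` alone gives the bound.
      rw [hc, Complex.ofReal_zero, zero_mul, zero_add, Complex.norm_real, Real.norm_eq_abs]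
      have : |g 1 1|⁻¹ ≤ |g 1 1|⁻¹ * height τ := le_mul_of_one_le_right (by positivity) hH
      simpa using this
    · have h1 : |g 1 0| * τ.im ≤ ‖(g 1 0 : ℂ) * τ + (g 1 1 : ℂ)‖ := by
        refine le_trans ?_ (Complex.abs_im_le_norm _)
        simp [abs_mul, abs_of_pos hv]
      have h2 : 0 < |g 1 0| * τ.im := by positivity
      calc _ ≤ (|g 1 0| * τ.im)⁻¹ := inv_anti₀ h2 h1
        _ = |g 1 0|⁻¹ * τ.im⁻¹ := mul_inv _ _
        _ ≤ |g 1 0|⁻¹ * height τ := by gcongr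
        _ ≤ _ := le_add_of_nonneg_right (by positivity)
  have hH0 : 0 ≤ height τ := by linarith
  refine ⟨b1.trans ?_, b2.trans ?_, ?_⟩
  · gcongr; linarith
  · gcongr; linarith
  · have h1 : ‖((g • τ : ℍ) : ℂ)‖ ≤ (|g 0 0| + |g 0 1|) * height τ * (A₂ * height τ) := by
      rw [coe_smul, norm_div, div_eq_mul_inv]
      exact mul_le_mul (hlin _ _) b2 (by positivity) (by positivity)
    have h2 : (g • τ).im⁻¹ ≤ (A₁ * height τ) ^ 2 * height τ := by
      rw [im_smul, inv_div, div_eq_mul_inv, Complex.normSq_eq_norm_sq]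
      gcongr
    have h3 : height τ ^ 2 ≤ height τ ^ 3 := pow_le_pow_right₀ hH (by norm_num)
    calc height (g • τ) ≤ (|g 0 0| + |g 0 1|) * A₂ * height τ ^ 2 + A₁ ^ 2 * height τ ^ 3 := by
          rw [height]; linarith
      _ ≤ (|g 0 0| + |g 0 1|) * A₂ * height τ ^ 3 + A₁ ^ 2 * height τ ^ 3 := by gcongr
      _ = A₃ * height τ ^ 3 := by ring
      _ ≤ _ := by gcongr; linarith

theorem periodModule_slash {k m : ℤ} {F : JFun} (g : RealJacobi) (hF : F ∈ periodModule m) :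
    slash k m F g ∈ periodModule m := by
  rw [mem_periodModule_iff] at *
  obtain ⟨h1, C, N, hC, h2⟩ := hF
  obtain ⟨A, hA, hb⟩ := exists_height_bound g.mat
  refine ⟨differentiableOn_slash g h1, A ^ k.natAbs * (C * A ^ N), k.natAbs + 3 * N,
    by positivity, fun τ z => ?_⟩
  have h0 : 0 < height τ := by linarith [two_le_height τ]
  have h0' : 0 < height (g.mat • τ) := by linarith [two_le_height (g.mat • τ)]
  obtain ⟨b1, b2, b3⟩ := hb τ
  rw [norm_slash_mul_exp]
  have h3 : ‖(g.mat 1 0 : ℂ) * τ + (g.mat 1 1 : ℂ)‖ ^ (-k) ≤ (A * height τ) ^ k.natAbs := by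
    rcases Int.natAbs_eq k with hk | hk
    · rw [hk, zpow_neg, zpow_natCast, ← inv_pow, Int.natAbs_natCast]
      gcongr
    · rw [hk, neg_neg, zpow_natCast, Int.natAbs_neg, Int.natAbs_natCast]
      gcongr
  calc _ ≤ (A * height τ) ^ k.natAbs * (C * height (g.mat • τ) ^ N) :=
        mul_le_mul h3 (h2 _ _) (by positivity) (by positivity)
    _ ≤ (A * height τ) ^ k.natAbs * (C * (A * height τ ^ 3) ^ N) := by gcongr
    _ = _ := by rw [mul_pow, mul_pow, ← pow_mul]; ring

/-- The decay condition on Jacobi integrals as `v, y → ∞`. -/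
def Decays (k m : ℤ) (f : JFun) : Prop :=
  Tendsto (fun p : ℍ × ℂ => ‖f p.1 p.2‖ * p.1.im ^ (-(k : ℝ) / 2) *
      Real.exp (-(2 * Real.pi * m * p.2.im ^ 2 / p.1.im)))
    (comap (fun p : ℍ × ℂ => (p.1.im, p.2.im)) (atTop ×ˢ atTop)) (𝓝 0)

theorem Decays.zero (k m : ℤ) : Decays k m 0 := by
  simpa [Decays] using tendsto_const_nhds

theorem Decays.add {k m : ℤ} {F G : JFun} (hF : Decays k m F) (hG : Decays k m G) :
    Decays k m (F + G) := by
  have h := Tendsto.add hF hG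
  rw [add_zero] at h
  refine squeeze_zero (fun p => ?_) (fun p => ?_) h
  · have := Real.rpow_nonneg p.1.im_pos.le (-(k : ℝ) / 2)
    positivity
  · have := Real.rpow_nonneg p.1.im_pos.le (-(k : ℝ) / 2)
    rw [← add_mul, ← add_mul]
    gcongr
    exact norm_add_le _ _

theorem Decays.smul {k m : ℤ} {F : JFun} (s : ℂ) (hF : Decays k m F) : Decays k m (s • F) := by
  have h := Tendsto.const_mul ‖s‖ hF
  rw [mul_zero] at h
  refine h.congr fun p => ?_
  simp only [Pi.smul_apply, norm_smul]
  ring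

/-- Upper triangular elements with positive diagonal and `λ ≥ 0` map the region `v, y → ∞` into
itself, hence preserve the decay condition. -/
theorem decays_slash {k m : ℤ} {F : JFun} (hF : Decays k m F) {g : RealJacobi}
    (hc : g.mat 1 0 = 0) (hd : 0 < g.mat 1 1) (hlam : 0 ≤ g.lam) :
    Decays k m (slash k m F g) := by
  obtain ⟨δ, hδ⟩ : ∃ δ, g.mat 1 1 = δ := ⟨_, rfl⟩
  rw [hδ] at hd
  have him (p : ℍ × ℂ) : (g.mat • p.1).im = p.1.im / δ ^ 2 := by
    rw [im_smul, hc, hδ, Complex.ofReal_zero, zero_mul, zero_add, Complex.normSq_ofReal, pow_two]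
  have hmove (p : ℍ × ℂ) : (move g (p.1, p.2)).2.im = (p.2.im + g.lam * p.1.im) / δ := by
    simp only [move, hc, hδ, Complex.ofReal_zero, zero_mul, zero_add]
    rw [Complex.div_ofReal_im]
    simp
  have ht : Tendsto (fun p : ℍ × ℂ => (g.mat • p.1, (move g (p.1, p.2)).2))
      (comap (fun p : ℍ × ℂ => (p.1.im, p.2.im)) (atTop ×ˢ atTop))
      (comap (fun p : ℍ × ℂ => (p.1.im, p.2.im)) (atTop ×ˢ atTop)) := by
    have hv : Tendsto (fun p : ℍ × ℂ => p.1.im)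
        (comap (fun p : ℍ × ℂ => (p.1.im, p.2.im)) (atTop ×ˢ atTop)) atTop :=
      tendsto_fst.comp tendsto_comap
    have hy : Tendsto (fun p : ℍ × ℂ => p.2.im)
        (comap (fun p : ℍ × ℂ => (p.1.im, p.2.im)) (atTop ×ˢ atTop)) atTop :=
      tendsto_snd.comp tendsto_comap
    rw [tendsto_comap_iff]
    refine Tendsto.prodMk ?_ ?_
    · simp only [him]
      exact hv.atTop_div_const (by positivity)
    · simp only [hmove]
      refine Tendsto.atTop_div_const hd (tendsto_atTop_mono (fun p => ?_) hy)
      have := mul_nonneg hlam p.1.im_pos.le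
      linarith
  have h := (Tendsto.comp hF ht).const_mul (δ ^ (-k) * (δ ^ (-k)))
  rw [mul_zero] at h
  refine h.congr fun p => ?_
  have e1 := norm_slash_mul_exp k m F g p.1 p.2
  have e2 : (p.1.im / δ ^ 2) ^ (-(k : ℝ) / 2) = δ ^ k * p.1.im ^ (-(k : ℝ) / 2) := by
    rw [Real.div_rpow p.1.im_pos.le (by positivity), ← Real.rpow_natCast δ 2,
      ← Real.rpow_mul hd.le, div_eq_inv_mul, ← Real.rpow_neg hd.le, ← Real.rpow_intCast]
    congr 2
    push_cast
    ring
  have e3 : δ ^ (-k) * δ ^ k = 1 := by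
    rw [zpow_neg, inv_mul_cancel₀ (zpow_ne_zero _ hd.ne')]
  rw [mul_right_comm (‖slash k m F g p.1 p.2‖), e1, hc, hδ, Complex.ofReal_zero, zero_mul, zero_add,
    Complex.norm_real, Real.norm_eq_abs, abs_of_pos hd]
  simp only [Function.comp_apply]
  rw [him, e2]
  linear_combination (δ ^ (-k) * ‖F (g.mat • p.1) (move g (p.1, p.2)).2‖ *
    p.1.im ^ (-(k : ℝ) / 2) * Real.exp (-(2 * Real.pi * m * (move g (p.1, p.2)).2.im ^ 2 /
      (p.1.im / δ ^ 2)))) * e3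

/-! ### The Hecke operator preserves the space of Jacobi integrals -/

variable {k m : ℤ} {n : ℕ} {f : JFun}

/-- A property that is closed under sums passes from the terms to `latticeSum`. -/
theorem latticeSum_induction {p : JFun → Prop} (h0 : p 0) (hadd : ∀ F G, p F → p G → p (F + G))
    {a b c d : ℤ} (h : ∀ X Y : ℕ, p (slash k m f (ofInt a b c d X Y))) :
    p (latticeSum k m n f a b c d) :=
  Finset.sum_induction _ p hadd h0 fun X _ => Finset.sum_induction _ p hadd h0 fun Y _ => h X Y

theorem heckeT_induction {p : JFun → Prop} (h0 : p 0) (hadd : ∀ F G, p F → p G → p (F + G))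
    (hsmul : ∀ (s : ℂ) F, p F → p (s • F))
    (h : ∀ a b d : ℤ, a * d = (n : ℤ) ^ 2 → 0 < d → ∀ X Y : ℕ,
      p (slash k m f (ofInt a b 0 d X Y))) : p (heckeT k m n f) := by
  refine hsmul _ _ (Finset.sum_induction _ p hadd h0 ?_)
  rintro ⟨a, b, c, d⟩ hp
  obtain ⟨h1, rfl, -, hd, -⟩ := mem_heckeIndex.1 hp
  exact latticeSum_induction h0 hadd (h a b d h1 hd)

theorem latticeSum_mem_periodModule (hf : f ∈ periodModule m) (a b c d : ℤ) :
    latticeSum k m n f a b c d ∈ periodModule m :=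
  latticeSum_induction (periodModule_zero m) (fun _ _ => periodModule_add)
    fun _ _ => periodModule_slash _ hf

theorem heckeT_mem_EJ (hn : 0 < n) (hf : f ∈ EJ k m) : heckeT k m n f ∈ EJ k m := by
  have hinv := EJ.latticeInvariant hf
  have hT := hf.1.slash_T
  refine ⟨⟨?_, fun τ z => ?_, fun τ z => ?_, fun γ lam mu => ?_, ?_⟩,
    heckeT_slash_lattice hinv hn 1 0⟩
  · refine heckeT_induction (p := fun F => AnalyticOnNhd ℝ (extend F) domain)
      (fun _ _ => analyticAt_const) (fun F G hF hG => hF.add hG)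
      (fun s F hF p hp => (analyticAt_const (v := s)).smul (hF p hp)) fun a b d _ _ X Y =>
        analyticOnNhd_slash _ hf.1.analytic
  · rw [← slash_translation_tau k m (heckeT k m n f), heckeT_slash_T hinv hn hT]
  · rw [← slash_translation_z k m (heckeT k m n f), heckeT_slash_lattice hinv hn]
  · obtain ⟨σ, δ, hσ, hsum⟩ := exists_hecke_perm hn γ
    rw [heckeT_slash_sub hinv hn γ lam mu hσ hsum]
    exact periodModule_smul _ (periodModule_sum fun p _ =>
      latticeSum_mem_periodModule (hf.1.period (δ p) 0 0) _ _ _ _)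
  · refine heckeT_induction (p := Decays k m) (Decays.zero k m) (fun F G => Decays.add)
      (fun s F => Decays.smul s) fun a b d h hd X Y => ?_
    have hmat := normalized_coe hn (show a * d - b * 0 = (n : ℤ) ^ 2 by linarith)
    -- The representatives `0 ≤ X < n` are what makes the decay condition, which concerns
    -- `y → ∞` only, survive the lattice translations.
    refine decays_slash hf.1.growth ?_ ?_ ?_
    · simp [ofInt, hmat]
    · have : (0 : ℝ) < d / n := by positivity
      simpa [ofInt, hmat] using this
    · simp [ofInt]

end

end JacobiHecke

theorem theorem2p2 (k m : ℤ) (n : ℕ) (hn : 0 < n) :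
    -- the sums over residue classes do not depend on the representatives
    (∀ f ∈ JacobiHecke.EJ k m, ∀ P : JacobiHecke.JFun,
      JacobiHecke.slash k m f JacobiHecke.elT = f + P →
      ∀ F ∈ ({f, P} : Set JacobiHecke.JFun), ∀ a b c d X Y X' Y' : ℤ,
        a * d - b * c = (n : ℤ) ^ 2 → X ≡ X' [ZMOD n] → Y ≡ Y' [ZMOD n] →
        JacobiHecke.slash k m F (JacobiHecke.ofInt a b c d X Y) =
          JacobiHecke.slash k m F (JacobiHecke.ofInt a b c d X' Y')) ∧
    (∀ f ∈ JacobiHecke.EJ k m, ∀ a b b' d X Y : ℤ,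
        a * d = (n : ℤ) ^ 2 → b ≡ b' [ZMOD d] →
        JacobiHecke.slash k m f (JacobiHecke.ofInt a b 0 d X Y) =
          JacobiHecke.slash k m f (JacobiHecke.ofInt a b' 0 d X Y)) ∧
    -- the Hecke operator preserves the space
    (∀ f ∈ JacobiHecke.EJ k m, JacobiHecke.heckeT k m n f ∈ JacobiHecke.EJ k m) ∧
    -- the period function of the image
    (∀ f ∈ JacobiHecke.EJ k m, ∀ P Q : JacobiHecke.JFun,
      JacobiHecke.slash k m f JacobiHecke.elT = f + P →
      JacobiHecke.slash k m (JacobiHecke.heckeT k m n f) JacobiHecke.elT =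
        JacobiHecke.heckeT k m n f + Q →
      JacobiHecke.slash k m P (JacobiHecke.ofSLZ (-1) 1 0) = P →
      Q = (n : ℂ) ^ (k - 4) • JacobiHecke.tildeT k m n P) := by
  refine ⟨?_, ?_, fun f hf => JacobiHecke.heckeT_mem_EJ hn hf, ?_⟩
  · rintro f hf P hfP F hF a b c d X Y X' Y' h hX hY
    have hinv := JacobiHecke.EJ.latticeInvariant hf
    refine JacobiHecke.LatticeInvariant.slash_ofInt_congr ?_ hn h hX hY
    rcases hF with rfl | rfl
    · exact hinv
    · exact JacobiHecke.latticeInvariant_period hinv hfP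
  · intro f hf a b b' d X Y h hb
    exact JacobiHecke.slash_ofInt_upper hf.1.slash_T hn h hb X Y
  · intro f hf P Q hfP hQ hPI
    rw [← JacobiHecke.period_heckeT hn (JacobiHecke.EJ.latticeInvariant hf) hf.1.slash_T hfP hPI,
      hQ, add_sub_cancel_left]
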